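/- Let $1\le r<\infty$ and let $m\ge 2$ be an integer. Let $X=(X_i)_{i\ge1}$ and $Y=(Y_i)_{i\ge1}$ be two independent sequences of iid random variables with values in a finite alphabet $\mathcal A_m=\{\alpha_1,\dots,\alpha_m\}$, with $\mathbb P(X_1=\alpha_k)=\mathbb P(Y_1=\alpha_k)=p_k$ for $k=1,\dots,m$. For $n\ge1$ let $LC_n$ be the length of the longest common subsequence of the words $X_1\cdots X_n$ and $Y_1\cdots Y_n$, i.e. the largest $k$ such that there exist $1\le i_1<\dots<i_k\le n$ and $1\le j_1<\dots<j_k\le n$ with $X_{i_s}=Y_{j_s}$ for $s=1,\dots,k$. Put $$K=\min\left(2^{-4}\,10^{-2}\,e^{-67},\ \frac{1}{800\,m}\right),$$ and suppose that for some $j_0\in\{1,\dots,m\}$ $$\frac12<p_{j_0}<1\qquad\text{and}\qquad \max_{j\ne j_0}p_j\le\min\left(\frac{2^{-2}e^{-5}K}{m},\ \frac{K}{2m^2}\right).$$ Then there is a constant $C>0$, depending only on $r$, $m$, $p_{j_0}$ and $\max_{j\ne j_0}p_j$, such that for all $n\ge1$ $$\mathbb E\left|LC_n-\mathbb E\,LC_n\right|^r\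 \ge\ C\,n^{r/2}.$$ -/

import Mathlib

namespace LCS

/-- The words `x` and `y` have a common subsequence of length `k`. -/
def HasCommonSubseq {α : Type*} {n : ℕ} (x y : Fin n → α) (k : ℕ) : Prop :=
  ∃ i j : Fin k → Fin n, StrictMono i ∧ StrictMono j ∧ ∀ s, x (i s) = y (j s)

/-- Length of the longest common subsequence of two words of length `n`. -/
noncomputable def lcsLength {α : Type*} {n : ℕ} (x y : Fin n → α) : ℕ :=
  sSup {k : ℕ | HasCommonSubseq x y k}

/-- The supremum defining `lcsLength` is a maximum. -/
theorem isGreatest_lcsLength {α : Type*} {n : ℕ} (x y : Fin n → α) :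
    IsGreatest {k : ℕ | HasCommonSubseq x y k} (lcsLength x y) := by
  have hne : {k : ℕ | HasCommonSubseq x y k}.Nonempty :=
    ⟨0, Fin.elim0, Fin.elim0, fun a => a.elim0, fun a => a.elim0, fun a => a.elim0⟩
  have hbd : BddAbove {k : ℕ | HasCommonSubseq x y k} := by
    refine ⟨n, ?_⟩
    rintro k ⟨i, -, hi, -, -⟩
    simpa using Fintype.card_le_of_injective i hi.injective
  exact ⟨Nat.sSup_mem hne hbd, fun k hk => le_csSup hbd hk⟩

/-- The random variable `LC_n`: the length of the longest common subsequence of the words formed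
by the first `n` letters of the sequences `X` and `Y` (indexed from `0`). -/
noncomputable def LC {Ω α : Type*} (X Y : ℕ → Ω → α) (n : ℕ) (ω : Ω) : ℝ :=
  (lcsLength (fun i : Fin n => X i ω) (fun i : Fin n => Y i ω) : ℝ)

/-- The `r`-th absolute central moment `E |Z - E Z| ^ r`. -/
noncomputable def absCentralMoment {Ω : Type*} [MeasurableSpace Ω] (μ : MeasureTheory.Measure Ω)
    (Z : Ω → ℝ) (r : ℝ) : ℝ :=
  ∫ ω, |Z ω - ∫ ω', Z ω' ∂μ| ^ r ∂μ

/-- `X` and `Y` are two independent sequences of iid random variables with values in an `m`-letter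
alphabet, every letter `k` having probability `p k`. -/
structure IsIIDPair {Ω : Type*} [MeasurableSpace Ω] (μ : MeasureTheory.Measure Ω) {m : ℕ}
    (p : Fin m → ℝ) (X Y : ℕ → Ω → Fin m) : Prop where
  measurable_X : ∀ i, Measurable (X i)
  measurable_Y : ∀ i, Measurable (Y i)
  indep_X : ProbabilityTheory.iIndepFun X μ
  indep_Y : ProbabilityTheory.iIndepFun Y μ
  indep_XY : ProbabilityTheory.IndepFun (fun ω i => X i ω) (fun ω i => Y i ω) μ
  law_X : ∀ i k, μ.real (X i ⁻¹' {k}) = p k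
  law_Y : ∀ i k, μ.real (Y i ⁻¹' {k}) = p k

/-- The constant `K = min (2⁻⁴ 10⁻² e⁻⁶⁷, 1 / (800 m))`. -/
noncomputable def K (m : ℕ) : ℝ :=
  min ((2 : ℝ)⁻¹ ^ 4 * (10 : ℝ)⁻¹ ^ 2 * Real.exp (-67)) (1 / (800 * (m : ℝ)))

end LCS

/-!
Call the letter `o` of probability close to one dominant and all other letters rare. For a pair of
words let `T` be the number of rare letters and `f` the length of the longest common subsequence,
and let `S` be the sum, over all rare letters of both words, of the change of `f` when that letter
is replaced by `o`. Resampling a single letter yields a discrete integration by parts, which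
expresses `p o * E[ψ (T - 1) * S]` as the mean of `f - E f` times a function of `T`. For a tent
function `ψ` of width of order `√n` around `E T` that function is of order `√n`, so that
`E[ψ (T - 1) * S]` is at most of order `√n * E|f - E f|`. It therefore suffices that `S` is at least
of order `n` with high probability, and Jensen's inequality passes from the exponent `1` to `r`.

To bound `S` from below, cut an optimal alignment at its matched rare letters, as finely as possible
without loss of score. Whenever a piece contains fewer letters `o` in one word than in the other,
every rare letter of the poorer piece raises the score when it is replaced by `o`. Hence, if `S` is
small, most pieces are balanced, and moreover they admit no further matching of rare letters without
loss. The generating function of the pairs of words with such an alignment converges even if all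
letter weights are multiplied by `1 + q ^ 2 / 1000`, so these pairs have exponentially small
probability.
-/

namespace LCS

open scoped ENNReal

/-! ### Alignments of two words -/

section CommonSublist

variable {A : Type*} {x y x' y' : List A} {k k' : ℕ}

/-- The lists `x` and `y` have a common sublist of length `k`: the list counterpart of
`HasCommonSubseq`, which allows words of different lengths and concatenation. -/
def CommonSublist (x y : List A) (k : ℕ) : Prop :=
  ∃ l : List A, l.Sublist x ∧ l.Sublist y ∧ l.length = k

theorem CommonSublist.append (h : CommonSublist x y k) (h' : CommonSublist x' y' k') :
    CommonSublist (x ++ x') (y ++ y') (k + k') := by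
  obtain ⟨l, hx, hy, rfl⟩ := h
  obtain ⟨l', hx', hy', rfl⟩ := h'
  exact ⟨l ++ l', hx.append hx', hy.append hy', List.length_append⟩

theorem CommonSublist.symm (h : CommonSublist x y k) : CommonSublist y x k := by
  obtain ⟨l, hx, hy, hl⟩ := h
  exact ⟨l, hy, hx, hl⟩

theorem CommonSublist.cons (a : A) (h : CommonSublist x y k) :
    CommonSublist (a :: x) (a :: y) (k + 1) := by
  obtain ⟨l, hx, hy, rfl⟩ := h
  exact ⟨a :: l, hx.cons_cons a, hy.cons_cons a, List.length_cons⟩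

theorem CommonSublist.cons_right (a b : A) (h : CommonSublist x y k) :
    CommonSublist (a :: x) (b :: y) k := by
  obtain ⟨l, hx, hy, hl⟩ := h
  exact ⟨l, hx.cons a, hy.cons b, hl⟩

/-- The length of the longest common sublist of `x` and `y`. -/
noncomputable def listLcs (x y : List A) : ℕ := sSup {k | CommonSublist x y k}

theorem isGreatest_listLcs (x y : List A) :
    IsGreatest {k | CommonSublist x y k} (listLcs x y) := by
  have hne : CommonSublist x y 0 := ⟨[], List.nil_sublist x, List.nil_sublist y, rfl⟩
  have hbdd : BddAbove {k | CommonSublist x y k} := by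
    refine ⟨x.length, ?_⟩
    rintro k ⟨l, hl, -, rfl⟩
    exact hl.length_le
  exact ⟨Nat.sSup_mem ⟨0, hne⟩ hbdd, fun k hk => le_csSup hbdd hk⟩

theorem CommonSublist.le_listLcs (h : CommonSublist x y k) : k ≤ listLcs x y :=
  (isGreatest_listLcs x y).2 h

theorem commonSublist_listLcs (x y : List A) : CommonSublist x y (listLcs x y) :=
  (isGreatest_listLcs x y).1

theorem listLcs_comm (x y : List A) : listLcs x y = listLcs y x :=
  le_antisymm (commonSublist_listLcs x y).symm.le_listLcs
    (commonSublist_listLcs y x).symm.le_listLcs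

theorem sublist_ofFn_iff {n : ℕ} (x : Fin n → A) (l : List A) :
    l.Sublist (List.ofFn x) ↔
      ∃ i : Fin l.length → Fin n, StrictMono i ∧ ∀ s, l.get s = x (i s) := by
  rw [List.sublist_iff_exists_fin_orderEmbedding_get_eq]
  constructor
  · rintro ⟨f, hf⟩
    refine ⟨fun s => Fin.cast (by simp) (f s), fun a b hab => f.strictMono hab, fun s => ?_⟩
    rw [hf, List.get_ofFn]
  · rintro ⟨i, hi, h⟩
    refine ⟨OrderEmbedding.ofStrictMono (fun s => Fin.cast (by simp) (i s))
      (fun a b hab => hi hab), fun s => ?_⟩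
    rw [h, List.get_ofFn]
    rfl

theorem hasCommonSubseq_iff {n : ℕ} (x y : Fin n → A) (k : ℕ) :
    HasCommonSubseq x y k ↔ CommonSublist (List.ofFn x) (List.ofFn y) k := by
  constructor
  · rintro ⟨i, j, hi, hj, hij⟩
    refine ⟨List.ofFn (x ∘ i),
      (sublist_ofFn_iff x _).2 ⟨i ∘ Fin.cast (by simp), fun a b hab => hi hab, fun s => ?_⟩,
      (sublist_ofFn_iff y _).2 ⟨j ∘ Fin.cast (by simp), fun a b hab => hj hab, fun s => ?_⟩,
      List.length_ofFn⟩
    · rw [List.get_ofFn]; rfl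
    · rw [List.get_ofFn]; exact hij _
  · rintro ⟨l, hx, hy, rfl⟩
    obtain ⟨i, hi, hxi⟩ := (sublist_ofFn_iff x l).1 hx
    obtain ⟨j, hj, hyj⟩ := (sublist_ofFn_iff y l).1 hy
    exact ⟨i, j, hi, hj, fun s => by rw [← hxi, ← hyj]⟩

theorem lcsLength_eq_listLcs {n : ℕ} (x y : Fin n → A) :
    lcsLength x y = listLcs (List.ofFn x) (List.ofFn y) := by
  simp only [lcsLength, listLcs, hasCommonSubseq_iff]

end CommonSublist

section Alignment

variable {A : Type*} (o : A)

/-- The rare letters are the letters other than the distinguished letter `o`. -/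
abbrev Rare : Type _ := {a : A // a ≠ o}

/-- An alignment of two words with respect to a distinguished letter `o`: both words are cut into
the same number of pieces, and two consecutive pairs of pieces are separated by a rare letter at
which the two words are matched. Inside a pair of pieces only letters `o` are matched. -/
inductive Alignment : Type _
  | single (x y : List A)
  | cons (x y : List A) (a : Rare o) (π : Alignment)

variable {o}

namespace Alignment

/-- The first of the two words aligned by `π`. -/
def fst : Alignment o → List A
  | single x _ => x
  | cons x _ a π => x ++ a.1 :: π.fst

/-- The second of the two words aligned by `π`. -/
def snd : Alignment o → List A
  | single _ y => y
  | cons _ y a π => y ++ a.1 :: π.snd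

/-- The number of matched rare letters. -/
def length : Alignment o → ℕ
  | single _ _ => 0
  | cons _ _ _ π => π.length + 1

/-- The same alignment with the roles of the two words exchanged. -/
def swap : Alignment o → Alignment o
  | single x y => single y x
  | cons x y a π => cons y x a π.swap

/-- Prepend the words `u` and `v` to the first pair of pieces of an alignment. -/
def prepend (u v : List A) : Alignment o → Alignment o
  | single x y => single (u ++ x) (v ++ y)
  | cons x y a π => cons (u ++ x) (v ++ y) a π

variable (π : Alignment o)

@[simp] theorem fst_swap : π.swap.fst = π.snd := by
  induction π with simp_all [swap, fst, snd]

@[simp] theorem snd_swap : π.swap.snd = π.fst := by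
  induction π with simp_all [swap, fst, snd]

@[simp] theorem length_swap : π.swap.length = π.length := by
  induction π with simp_all [swap, length]

@[simp] theorem fst_prepend (u v : List A) : (π.prepend u v).fst = u ++ π.fst := by
  cases π <;> simp [prepend, fst]

@[simp] theorem snd_prepend (u v : List A) : (π.prepend u v).snd = v ++ π.snd := by
  cases π <;> simp [prepend, snd]

theorem length_le_length_fst : π.length ≤ π.fst.length := by
  induction π with
  | single x y => exact Nat.zero_le _
  | cons x y a π ih => simp only [length, fst, List.length_append, List.length_cons]; omega

end Alignment

variable [DecidableEq A]

theorem commonSublist_min_count (o : A) (x y : List A) :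
    CommonSublist x y (min (x.count o) (y.count o)) :=
  ⟨List.replicate (min (x.count o) (y.count o)) o,
    List.replicate_sublist_iff.2 (min_le_left _ _),
    List.replicate_sublist_iff.2 (min_le_right _ _), List.length_replicate⟩

namespace Alignment

/-- The length of the common sublist described by an alignment, which matches as many letters `o`
as possible in each pair of pieces. -/
def score : Alignment o → ℕ
  | single x y => min (x.count o) (y.count o)
  | cons x y _ π => min (x.count o) (y.count o) + 1 + π.score

@[simp] theorem score_swap (π : Alignment o) : π.swap.score = π.score := by
  induction π with simp_all [swap, score, min_comm]

theorem score_le_score_prepend (u v : List A) (π : Alignment o) :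
    min (u.count o) (v.count o) + π.score ≤ (π.prepend u v).score := by
  cases π <;> simp only [prepend, score, List.count_append] <;> omega

theorem commonSublist_score (π : Alignment o) : CommonSublist π.fst π.snd π.score := by
  induction π with
  | single x y => exact commonSublist_min_count o x y
  | cons x y a π ih =>
    simpa only [fst, snd, score, add_assoc, add_comm 1] using
      (commonSublist_min_count o x y).append (ih.cons a.1)

theorem score_le_listLcs (π : Alignment o) : π.score ≤ listLcs π.fst π.snd :=
  π.commonSublist_score.le_listLcs

/-- An alignment is optimal if it describes a longest common sublist. -/
def IsOptimal (π : Alignment o) : Prop := π.score = listLcs π.fst π.snd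

end Alignment

theorem exists_alignment_of_sublist (o : A) {l x y : List A} (hx : l.Sublist x)
    (hy : l.Sublist y) : ∃ π : Alignment o, π.fst = x ∧ π.snd = y ∧ l.length ≤ π.score := by
  induction l generalizing x y with
  | nil => exact ⟨.single x y, rfl, rfl, Nat.zero_le _⟩
  | cons a l ih =>
    obtain ⟨u, x, rfl, hau, hx⟩ := List.cons_sublist_iff.1 hx
    obtain ⟨v, y, rfl, hav, hy⟩ := List.cons_sublist_iff.1 hy
    obtain ⟨π, rfl, rfl, hπ⟩ := ih hx hy
    by_cases ha : a = o
    · subst ha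
      refine ⟨π.prepend u v, π.fst_prepend u v, π.snd_prepend u v, ?_⟩
      have hu := List.count_pos_iff.2 hau
      have hv := List.count_pos_iff.2 hav
      have hπ' := π.score_le_score_prepend u v
      simp only [List.length_cons]
      omega
    · obtain ⟨u, u', rfl⟩ := List.append_of_mem hau
      obtain ⟨v, v', rfl⟩ := List.append_of_mem hav
      refine ⟨.cons u v ⟨a, ha⟩ (π.prepend u' v'), by simp [Alignment.fst],
        by simp [Alignment.snd], ?_⟩
      have hπ' := π.score_le_score_prepend u' v'
      simp only [List.length_cons, Alignment.score]
      omega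

theorem exists_isOptimal (o : A) (x y : List A) :
    ∃ π : Alignment o, π.fst = x ∧ π.snd = y ∧ π.IsOptimal := by
  obtain ⟨l, hx, hy, hl⟩ := commonSublist_listLcs x y
  obtain ⟨π, rfl, rfl, hπ⟩ := exists_alignment_of_sublist o hx hy
  exact ⟨π, rfl, rfl, le_antisymm π.score_le_listLcs (hl ▸ hπ)⟩

/-- Matching a rare letter inside the pair `(x, y)` always loses at least one matched letter,
compared with matching letters `o` only. -/
def Unsplittable (o : A) (x y : List A) : Prop :=
  ∀ u v u' v' : List A, ∀ a : A, a ≠ o → x = u ++ a :: v → y = u' ++ a :: v' →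
    min (u.count o) (u'.count o) + 1 + min (v.count o) (v'.count o) < min (x.count o) (y.count o)

namespace Alignment

/-- An alignment is refined if all its pairs of pieces are unsplittable. -/
def Refined : Alignment o → Prop
  | single x y => Unsplittable o x y
  | cons x y _ π => Unsplittable o x y ∧ π.Refined

theorem exists_length_succ_of_not_refined {π : Alignment o} (hπ : ¬ π.Refined) :
    ∃ π' : Alignment o, π'.fst = π.fst ∧ π'.snd = π.snd ∧ π.score ≤ π'.score ∧
      π'.length = π.length + 1 := by
  induction π with
  | single x y =>
    simp only [Refined, Unsplittable, not_forall, not_lt] at hπ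
    obtain ⟨u, v, u', v', a, ha, rfl, rfl, hle⟩ := hπ
    exact ⟨.cons u u' ⟨a, ha⟩ (.single v v'), rfl, rfl, hle, rfl⟩
  | cons x y b π ih =>
    by_cases hxy : Unsplittable o x y
    · obtain ⟨π', h₁, h₂, hs, hl⟩ := ih fun h => hπ ⟨hxy, h⟩
      exact ⟨.cons x y b π', by simp only [fst, h₁], by simp only [snd, h₂],
        by simpa only [score, add_le_add_iff_left] using hs, by simp only [length, hl]⟩
    · simp only [Unsplittable, not_forall, not_lt] at hxy
      obtain ⟨u, v, u', v', a, ha, rfl, rfl, hle⟩ := hxy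
      refine ⟨.cons u u' ⟨a, ha⟩ (.cons v v' b π), by simp [fst], by simp [snd], ?_, rfl⟩
      simp only [score]
      omega

end Alignment

theorem exists_isOptimal_refined (o : A) (x y : List A) :
    ∃ π : Alignment o, π.fst = x ∧ π.snd = y ∧ π.IsOptimal ∧ π.Refined := by
  obtain ⟨π, ⟨rfl, rfl, hopt⟩, hmin⟩ := exists_minimalFor_of_wellFoundedLT
    (fun π : Alignment o => π.fst = x ∧ π.snd = y ∧ π.IsOptimal)
    (fun π => x.length - π.length) (exists_isOptimal o x y)
  refine ⟨π, rfl, rfl, hopt, by_contra fun hπ => ?_⟩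
  obtain ⟨π', h₁, h₂, hscore, hlength⟩ := Alignment.exists_length_succ_of_not_refined hπ
  have hopt' : π'.IsOptimal := by
    refine le_antisymm π'.score_le_listLcs ?_
    rw [h₁, h₂, ← hopt]
    exact hscore
  have hle : π.fst.length - π.length ≤ π.fst.length - π'.length := by
    have := hmin (j := π') ⟨h₁, h₂, hopt'⟩
    dsimp only at this
    omega
  have hbound := h₁ ▸ π'.length_le_length_fst
  omega

end Alignment

section Flip

variable {A : Type*} [DecidableEq A] (o : A)

/-- The number of rare letters of `x`. -/
def rares (x : List A) : ℕ := x.countP fun a => decide (a ≠ o)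

/-- The sum of `F` over all words obtained from `x` by changing one rare letter into `o`. -/
def sumFlip (F : List A → ℤ) : List A → ℤ
  | [] => 0
  | a :: x => (if a ≠ o then F (o :: x) else 0) + sumFlip (fun x' => F (a :: x')) x

theorem sumFlip_append (F : List A → ℤ) (u v : List A) :
    sumFlip o F (u ++ v) =
      sumFlip o (fun u' => F (u' ++ v)) u + sumFlip o (fun v' => F (u ++ v')) v := by
  induction u generalizing F with
  | nil => simp [sumFlip]
  | cons a u ih => simp [sumFlip, ih, add_assoc]

variable {o}

theorem sumFlip_mono {F F' : List A → ℤ} (h : F ≤ F') (x : List A) :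
    sumFlip o F x ≤ sumFlip o F' x := by
  induction x generalizing F F' with
  | nil => exact le_rfl
  | cons a x ih =>
    refine add_le_add ?_ (ih fun l => h (a :: l))
    split_ifs
    exacts [h _, le_rfl]

theorem mul_rares_le_sumFlip {F : List A → ℤ} {c : ℤ} {x : List A}
    (h : ∀ x' : List A, x'.count o = x.count o + 1 → c ≤ F x') :
    c * rares o x ≤ sumFlip o F x := by
  induction x generalizing F with
  | nil => simp [sumFlip, rares]
  | cons a x ih =>
    have htail := ih (F := fun x' => F (a :: x')) fun x' hx' => h _ (by
      simp only [List.count_cons, hx']; omega)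
    by_cases ha : a = o
    · simpa [sumFlip, rares, ha] using htail
    · have hhead := h (o :: x) (by simp [ha])
      have hrares : rares o (a :: x) = rares o x + 1 := by simp [rares, ha]
      simp only [sumFlip, hrares, ha, ne_eq, not_false_eq_true, if_true]
      push_cast
      linarith

variable (o)

/-- The number of letters of `x` whose change into `o` allows to match one more letter `o` of `y`:
all rare letters if `x` has fewer letters `o` than `y`, and none otherwise. -/
def gain (x y : List A) : ℕ := if x.count o < y.count o then rares o x else 0

theorem gain_le_sumFlip_min (x y : List A) :
    (gain o x y : ℤ) ≤ sumFlip o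
      (fun x' => (min (x'.count o) (y.count o) : ℤ) - min (x.count o) (y.count o)) x := by
  unfold gain
  split_ifs with hlt
  · simpa using mul_rares_le_sumFlip (c := 1) fun x' hx' => by omega
  · simpa using mul_rares_le_sumFlip (c := 0) fun x' hx' => by omega

namespace Alignment

variable {o} (π : Alignment o)

/-- The number of letters of the first word whose change into `o` increases the score. -/
def gain : Alignment o → ℕ
  | single x y => LCS.gain o x y
  | cons x y _ π => LCS.gain o x y + π.gain

/-- The number of unmatched letters `o` in both words. -/
def unmatched : Alignment o → ℕ
  | single x y => Nat.dist (x.count o) (y.count o)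
  | cons x y _ π => Nat.dist (x.count o) (y.count o) + π.unmatched

/- Flipping a matched letter breaks the match, which costs at most one; this is why the length of
the alignment is subtracted. -/
theorem gain_sub_length_le_sumFlip : (π.gain : ℤ) - π.length ≤
    sumFlip o (fun x' => (listLcs x' π.snd : ℤ) - π.score) π.fst := by
  induction π with
  | single x y =>
    simp only [gain, length, fst, snd, score, Nat.cast_zero, sub_zero]
    refine (gain_le_sumFlip_min o x y).trans (sumFlip_mono (fun x' => ?_) _)
    have := (commonSublist_min_count o x' y).le_listLcs
    dsimp only
    omega
  | cons x y a π ih =>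
    simp only [gain, length, fst, snd, score]
    rw [sumFlip_append, sumFlip, if_pos a.2]
    have hpiece := (gain_le_sumFlip_min o x y).trans (sumFlip_mono
      (F' := fun x' => (listLcs (x' ++ a.1 :: π.fst) (y ++ a.1 :: π.snd) : ℤ)
        - (min (x.count o) (y.count o) + 1 + π.score : ℕ)) (fun x' => by
          have := ((commonSublist_min_count o x' y).append
            (π.commonSublist_score.cons a.1)).le_listLcs
          dsimp only
          omega) _)
    have hmatch := ((commonSublist_min_count o x y).append
      (π.commonSublist_score.cons_right o a.1)).le_listLcs
    have htail := ih.trans (sumFlip_mono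
      (F' := fun x' => (listLcs (x ++ a.1 :: x') (y ++ a.1 :: π.snd) : ℤ)
        - (min (x.count o) (y.count o) + 1 + π.score : ℕ)) (fun x' => by
          have := ((commonSublist_min_count o x y).append
            ((commonSublist_listLcs x' π.snd).cons a.1)).le_listLcs
          dsimp only
          omega) _)
    push_cast at hpiece hmatch htail ⊢
    linarith

theorem gain_swap_sub_length_le_sumFlip : (π.swap.gain : ℤ) - π.length ≤
    sumFlip o (fun y' => (listLcs π.fst y' : ℤ) - π.score) π.snd := by
  simpa [listLcs_comm] using π.swap.gain_sub_length_le_sumFlip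

theorem unmatched_add_two_mul_score :
    π.unmatched + 2 * π.score = 2 * π.length + π.fst.count o + π.snd.count o := by
  induction π with
  | single x y => simp only [unmatched, score, length, fst, snd, Nat.dist]; omega
  | cons x y a π ih =>
    simp only [unmatched, score, length, fst, snd, Nat.dist, List.count_append,
      List.count_cons_of_ne a.2]
    omega

variable {π}

theorem IsOptimal.unmatched_le (hπ : π.IsOptimal) :
    (π.unmatched : ℤ) ≤ 2 * π.length + |(π.fst.count o : ℤ) - π.snd.count o| := by
  have hcount := π.unmatched_add_two_mul_score
  have hscore := (commonSublist_min_count o π.fst π.snd).le_listLcs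
  rw [← hπ] at hscore
  rcases abs_cases ((π.fst.count o : ℤ) - π.snd.count o) with h | h <;> omega

/-- The exponent of the generating function: it is small when changing one letter into `o` rarely
increases the score and when few letters `o` are unmatched. -/
def defect (π : Alignment o) : ℕ := π.gain + π.swap.gain + π.unmatched

end Alignment

variable {o}

/-- The sum of the changes of the length of the longest common sublist of `x` and `y` caused by
changing one letter of `x` or of `y` into `o`. -/
noncomputable def flipSum (o : A) (x y : List A) : ℤ :=
  sumFlip o (fun x' => (listLcs x' y : ℤ) - listLcs x y) x +
    sumFlip o (fun y' => (listLcs x y' : ℤ) - listLcs x y) y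

theorem Alignment.IsOptimal.defect_le {π : Alignment o} (hπ : π.IsOptimal) :
    (π.defect : ℤ) ≤ 4 * π.length + flipSum o π.fst π.snd +
      |(π.fst.count o : ℤ) - π.snd.count o| := by
  have hfst := π.gain_sub_length_le_sumFlip
  have hsnd := π.gain_swap_sub_length_le_sumFlip
  have hunm := hπ.unmatched_le
  rw [hπ] at hfst hsnd
  simp only [defect, flipSum]
  push_cast
  linarith

end Flip

/-! ### Generating functions of words and alignments -/

section Sums

theorem tsum_prod_mul {X Y : Type*} (f : X → ℝ≥0∞) (g : Y → ℝ≥0∞) :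
    ∑' d : X × Y, f d.1 * g d.2 = (∑' x, f x) * ∑' y, g y := by
  rw [ENNReal.tsum_prod', ← ENNReal.tsum_mul_right]
  exact tsum_congr fun x => ENNReal.tsum_mul_left (a := f x) (f := g)

theorem tsum_prod_map_ofFn {S : Type*} (f : S → ℝ≥0∞) (n : ℕ) :
    ∑' v : Fin n → S, ((List.ofFn v).map f).prod = (∑' s, f s) ^ n := by
  induction n with
  | zero => simp [tsum_fintype]
  | succ n ih =>
    rw [← (Fin.consEquiv fun _ : Fin (n + 1) => S).tsum_eq, pow_succ', ← ih, ← tsum_prod_mul]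
    exact tsum_congr fun d => by simp [Fin.consEquiv, List.ofFn_succ]

theorem tsum_prod_map_list {S : Type*} (f : S → ℝ≥0∞) :
    ∑' l : List S, (l.map f).prod = (1 - ∑' s, f s)⁻¹ := by
  rw [← List.equivSigmaTuple.symm.tsum_eq, ENNReal.tsum_sigma', ← ENNReal.tsum_geometric]
  exact tsum_congr fun n => tsum_prod_map_ofFn f n

end Sums

section WordWeights

variable {A : Type*}

/-- The weight of a word: the product of the weights `g a` of its letters. -/
noncomputable def wt (g : A → ℝ≥0∞) (x : List A) : ℝ≥0∞ := (x.map g).prod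

@[simp] theorem wt_nil (g : A → ℝ≥0∞) : wt g [] = 1 := by simp [wt]

@[simp] theorem wt_cons (g : A → ℝ≥0∞) (a : A) (x : List A) : wt g (a :: x) = g a * wt g x := by
  simp [wt]

@[simp] theorem wt_append (g : A → ℝ≥0∞) (x y : List A) :
    wt g (x ++ y) = wt g x * wt g y := by simp [wt]

theorem wt_ofFn (g : A → ℝ≥0∞) {n : ℕ} (x : Fin n → A) : wt g (List.ofFn x) = ∏ i, g (x i) := by
  simp [wt, List.map_ofFn, List.prod_ofFn]

/-- The weight of a pair of words. -/
noncomputable def pairWt (g : A → ℝ≥0∞) (d : List A × List A) : ℝ≥0∞ := wt g d.1 * wt g d.2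

variable {o : A}

/-- A word in the rare letters, read as a word in all letters. -/
def rareWord (w : List (Rare o)) : List A := w.map Subtype.val

variable (o) in
/-- The total weight of the words in the rare letters, that is, of the runs which separate the
letters `o` of a word. -/
noncomputable def runSum (g : A → ℝ≥0∞) : ℝ≥0∞ := ∑' w : List (Rare o), wt g (rareWord w)

theorem runSum_eq (g : A → ℝ≥0∞) : runSum o g = (1 - ∑' a : Rare o, g a)⁻¹ := by
  rw [runSum, ← tsum_prod_map_list]
  exact tsum_congr fun w => by simp [wt, rareWord]

variable [DecidableEq A]

@[simp] theorem count_rareWord (w : List (Rare o)) : (rareWord w).count o = 0 := by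
  simp [List.count_eq_zero, rareWord]

theorem exists_rareWord_eq {x : List A} (h : x.count o = 0) :
    ∃ w : List (Rare o), rareWord w = x := by
  rw [List.count_eq_zero] at h
  exact ⟨x.attach.map fun a => ⟨a.1, fun ha => h (ha ▸ a.2)⟩, by simp [rareWord, Function.comp_def]⟩

theorem exists_rareWord_append_eq {x : List A} {k : ℕ} (h : x.count o = k + 1) :
    ∃ (w : List (Rare o)) (x' : List A), x'.count o = k ∧ rareWord w ++ o :: x' = x := by
  have hmem : o ∈ x := List.count_pos_iff.1 (by omega)
  obtain ⟨u, x', rfl, hu⟩ := List.eq_append_cons_of_mem hmem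
  obtain ⟨w, rfl⟩ := exists_rareWord_eq (List.count_eq_zero.2 hu)
  exact ⟨w, x', by simpa using h, rfl⟩

variable (o)

/-- The total weight of the words with exactly `k` letters `o`. -/
noncomputable def countSum (g : A → ℝ≥0∞) (k : ℕ) : ℝ≥0∞ :=
  ∑' x : {x : List A // x.count o = k}, wt g x

theorem countSum_zero_le (g : A → ℝ≥0∞) : countSum o g 0 ≤ runSum o g := by
  let run (w : List (Rare o)) : {x : List A // x.count o = 0} := ⟨rareWord w, count_rareWord w⟩
  have hrun : Function.Surjective run := fun x => by
    obtain ⟨w, hw⟩ := exists_rareWord_eq x.2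
    exact ⟨w, Subtype.ext hw⟩
  exact ENNReal.tsum_le_tsum_comp_of_surjective hrun _

theorem countSum_succ_le (g : A → ℝ≥0∞) (k : ℕ) :
    countSum o g (k + 1) ≤ runSum o g * g o * countSum o g k := by
  let join (d : List (Rare o) × {x : List A // x.count o = k}) :
      {x : List A // x.count o = k + 1} := ⟨rareWord d.1 ++ o :: d.2, by simp [d.2.2]⟩
  have hjoin : Function.Surjective join := fun x => by
    obtain ⟨w, x', hx', h⟩ := exists_rareWord_append_eq x.2
    exact ⟨(w, ⟨x', hx'⟩), Subtype.ext h⟩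
  calc countSum o g (k + 1)
      ≤ ∑' d : List (Rare o) × {x : List A // x.count o = k}, wt g (join d) :=
        ENNReal.tsum_le_tsum_comp_of_surjective hjoin _
    _ = ∑' d : List (Rare o) × {x : List A // x.count o = k},
          wt g (rareWord d.1) * g o * wt g d.2 :=
        tsum_congr fun d => by simp only [join, wt_append, wt_cons, mul_assoc]
    _ = runSum o g * g o * countSum o g k := by
        rw [tsum_prod_mul (fun w : List (Rare o) => wt g (rareWord w) * g o)
          (fun x : {x : List A // x.count o = k} => wt g x), ENNReal.tsum_mul_right]
        rfl

theorem countSum_le (g : A → ℝ≥0∞) (k : ℕ) :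
    countSum o g k ≤ runSum o g * (runSum o g * g o) ^ k := by
  induction k with
  | zero => simpa using countSum_zero_le o g
  | succ k ih =>
    calc countSum o g (k + 1) ≤ runSum o g * g o * countSum o g k := countSum_succ_le o g k
      _ ≤ runSum o g * g o * (runSum o g * (runSum o g * g o) ^ k) := by gcongr
      _ = runSum o g * (runSum o g * g o) ^ (k + 1) := by ring

/-- The pairs of words whose second word contains more letters `o` than the first one. -/
def unbalancedPairs : Set (List A × List A) := {d | d.1.count o < d.2.count o}

/-- The total weight of the unbalanced pairs, with letter weights `g'` in the first and `g` in the
second word, and an additional weight `τ` for each letter `o` in excess. -/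
noncomputable def unbalancedSum (g' g : A → ℝ≥0∞) (τ : ℝ≥0∞) : ℝ≥0∞ :=
  ∑' d : unbalancedPairs o, wt g' d.1.1 * wt g d.1.2 * τ ^ (d.1.2.count o - d.1.1.count o)

theorem unbalancedSum_le_tsum_countSum (g' g : A → ℝ≥0∞) (τ : ℝ≥0∞) :
    unbalancedSum o g' g τ ≤
      ∑' k, ∑' j, countSum o g' k * countSum o g (k + j + 1) * τ ^ (j + 1) := by
  let pair (e : Σ kj : ℕ × ℕ, {x : List A // x.count o = kj.1} ×
      {y : List A // y.count o = kj.1 + kj.2 + 1}) : unbalancedPairs o :=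
    ⟨(e.2.1, e.2.2), by
      have := e.2.1.2
      have := e.2.2.2
      simp only [unbalancedPairs, Set.mem_ofPred_eq]
      omega⟩
  have hpair : Function.Surjective pair := by
    rintro ⟨⟨x, y⟩, hxy : x.count o < y.count o⟩
    exact ⟨⟨(x.count o, y.count o - x.count o - 1), ⟨x, rfl⟩, ⟨y, by dsimp only; omega⟩⟩, rfl⟩
  refine (ENNReal.tsum_le_tsum_comp_of_surjective hpair _).trans_eq ?_
  rw [ENNReal.tsum_sigma', ENNReal.tsum_prod']
  refine tsum_congr fun k => tsum_congr fun j => ?_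
  simp only [countSum]
  rw [← tsum_prod_mul, ← ENNReal.tsum_mul_right]
  refine tsum_congr fun d => ?_
  simp only [pair, d.1.2, d.2.2]
  congr 2
  omega

theorem unbalancedSum_le (g' g : A → ℝ≥0∞) (τ : ℝ≥0∞) :
    unbalancedSum o g' g τ ≤
      runSum o g' * runSum o g * (1 - (runSum o g' * g' o) * (runSum o g * g o))⁻¹ *
        ((runSum o g * g o * τ) * (1 - runSum o g * g o * τ)⁻¹) := by
  calc unbalancedSum o g' g τ
      ≤ ∑' k, ∑' j, countSum o g' k * countSum o g (k + j + 1) * τ ^ (j + 1) :=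
        unbalancedSum_le_tsum_countSum o g' g τ
    _ ≤ ∑' k, ∑' j, (runSum o g' * (runSum o g' * g' o) ^ k) *
          (runSum o g * (runSum o g * g o) ^ (k + j + 1)) * τ ^ (j + 1) := by
        gcongr <;> exact countSum_le o _ _
    _ = ∑' k, ∑' j, (runSum o g' * runSum o g *
          ((runSum o g' * g' o) * (runSum o g * g o)) ^ k) *
          ((runSum o g * g o * τ) * (runSum o g * g o * τ) ^ j) :=
        tsum_congr fun k => tsum_congr fun j => by ring
    _ = _ := by simp only [ENNReal.tsum_mul_left, ENNReal.tsum_mul_right, ENNReal.tsum_geometric]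

end WordWeights

section BalancedPairs

variable {A : Type*} {o : A}

variable (o) in
/-- The two runs of rare letters preceding the first two letters `o` of a word, for each of two
words. -/
abbrev Runs : Type _ := (List (Rare o) × List (Rare o)) × (List (Rare o) × List (Rare o))

/-- Prepend to two words the given runs, each of them followed by a letter `o`. -/
def joinRuns (Q : Runs o) (d : List A × List A) : List A × List A :=
  (rareWord Q.1.1 ++ o :: (rareWord Q.1.2 ++ o :: d.1),
    rareWord Q.2.1 ++ o :: (rareWord Q.2.2 ++ o :: d.2))

/-- The weight of four runs and of the four letters `o` which follow them. -/
noncomputable def runsWt (g : A → ℝ≥0∞) (Q : Runs o) : ℝ≥0∞ :=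
  wt g (rareWord Q.1.1) * wt g (rareWord Q.1.2) *
    (wt g (rareWord Q.2.1) * wt g (rareWord Q.2.2)) * g o ^ 4

theorem pairWt_joinRuns (g : A → ℝ≥0∞) (Q : Runs o) (d : List A × List A) :
    pairWt g (joinRuns Q d) = runsWt g Q * pairWt g d := by
  simp only [pairWt, joinRuns, runsWt, wt_append, wt_cons]
  ring

theorem tsum_runsWt (g : A → ℝ≥0∞) : ∑' Q : Runs o, runsWt g Q = (runSum o g * g o) ^ 4 := by
  simp only [runsWt, ENNReal.tsum_mul_right, ENNReal.tsum_prod', ENNReal.tsum_mul_left]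
  rw [← runSum]
  ring

/-- Runs in which one letter `a` occurs in both words and can be matched without loss: in the first
run of both words, in the second run of both words, or in the first run of the first word and the
second run of the second word. -/
def matchRuns : Rare o ⊕ Rare o ⊕ Rare o → Runs o
  | .inl a => (([a], []), ([a], []))
  | .inr (.inl a) => (([], [a]), ([], [a]))
  | .inr (.inr a) => (([a], []), ([], [a]))

theorem matchRuns_injective : Function.Injective (matchRuns (o := o)) := by
  rintro (a | a | a) (b | b | b) h <;> simp_all [matchRuns]

variable (o) in
/-- The total weight of the runs which are not of the form `matchRuns`. -/
noncomputable def freeRunsSum (g : A → ℝ≥0∞) : ℝ≥0∞ :=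
  ∑' Q : ((Set.range matchRuns)ᶜ : Set (Runs o)), runsWt g Q.1

theorem tsum_range_matchRuns [Fintype (Rare o)] (g : A → ℝ≥0∞) :
    ∑' Q : (Set.range matchRuns : Set (Runs o)), runsWt g Q.1 =
      3 * (∑ a : Rare o, g a ^ 2) * g o ^ 4 := by
  rw [tsum_range _ matchRuns_injective, tsum_fintype, Fintype.sum_sum_type, Fintype.sum_sum_type]
  simp only [matchRuns, runsWt, rareWord, List.map_cons, List.map_nil, wt_cons, wt_nil,
    mul_one, one_mul, ← sq, ← Finset.sum_mul]
  ring

theorem freeRunsSum_add [Fintype (Rare o)] (g : A → ℝ≥0∞) :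
    freeRunsSum o g + 3 * (∑ a : Rare o, g a ^ 2) * g o ^ 4 = (runSum o g * g o) ^ 4 := by
  rw [← tsum_runsWt, ← tsum_range_matchRuns, add_comm, freeRunsSum]
  exact ENNReal.summable.tsum_add_tsum_compl ENNReal.summable

variable [DecidableEq A]

theorem Unsplittable.of_joinRuns {Q : Runs o} {d : List A × List A}
    (h : Unsplittable o (joinRuns Q d).1 (joinRuns Q d).2) : Unsplittable o d.1 d.2 := by
  intro u v u' v' a ha hu hu'
  have := h (rareWord Q.1.1 ++ o :: (rareWord Q.1.2 ++ o :: u)) v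
    (rareWord Q.2.1 ++ o :: (rareWord Q.2.2 ++ o :: u')) v' a ha (by simp [joinRuns, hu])
    (by simp [joinRuns, hu'])
  simp only [joinRuns, List.count_append, List.count_cons_self, count_rareWord] at this
  omega

theorem not_unsplittable_joinRuns_matchRuns (s : Rare o ⊕ Rare o ⊕ Rare o) {d : List A × List A}
    (hd : d.1.count o = d.2.count o) :
    ¬ Unsplittable o (joinRuns (matchRuns s) d).1 (joinRuns (matchRuns s) d).2 := by
  intro h
  rcases s with a | a | a
  · have := h [] (o :: o :: d.1) [] (o :: o :: d.2) a a.2 rfl rfl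
    simp [joinRuns, matchRuns, rareWord, a.2, hd] at this
    omega
  · have := h [o] (o :: d.1) [o] (o :: d.2) a a.2 rfl rfl
    simp [joinRuns, matchRuns, rareWord, a.2, hd] at this
  · have := h [] (o :: o :: d.1) [o] (o :: d.2) a a.2 rfl rfl
    simp [joinRuns, matchRuns, rareWord, a.2, hd] at this

variable (o)

/-- The unsplittable pairs of words with `k` letters `o` each. -/
def balancedPairs (k : ℕ) : Set (List A × List A) :=
  {d | d.1.count o = k ∧ d.2.count o = k ∧ Unsplittable o d.1 d.2}

/-- The total weight of the unsplittable pairs of words with `k` letters `o` each. -/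
noncomputable def balancedSum (g : A → ℝ≥0∞) (k : ℕ) : ℝ≥0∞ :=
  ∑' d : balancedPairs o k, pairWt g d

theorem balancedSum_le (g : A → ℝ≥0∞) (k : ℕ) :
    balancedSum o g k ≤ (runSum o g * (runSum o g * g o) ^ k) ^ 2 := by
  let words (d : balancedPairs o k) :
      {x : List A // x.count o = k} × {x : List A // x.count o = k} :=
    (⟨d.1.1, d.2.1⟩, ⟨d.1.2, d.2.2.1⟩)
  have hwords : Function.Injective words := fun d d' h => by
    simpa [words, Subtype.ext_iff, Prod.ext_iff] using h
  calc balancedSum o g k ≤ ∑' e : {x : List A // x.count o = k} × {x : List A // x.count o = k},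
        wt g e.1 * wt g e.2 :=
        ENNReal.tsum_comp_le_tsum_of_injective hwords fun e => wt g e.1 * wt g e.2
    _ = countSum o g k ^ 2 := by
        rw [tsum_prod_mul (fun x : {x : List A // x.count o = k} => wt g x)
          (fun x : {x : List A // x.count o = k} => wt g x), sq, countSum]
    _ ≤ _ := by gcongr; exact countSum_le o g k

variable {o}

theorem exists_joinRuns_eq {d : List A × List A} {k : ℕ} (hd : d ∈ balancedPairs o (k + 2)) :
    ∃ Q ∈ (Set.range (matchRuns (o := o)))ᶜ, ∃ d' ∈ balancedPairs o k, joinRuns Q d' = d := by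
  obtain ⟨h₁, h₂, hunsplit⟩ := hd
  obtain ⟨w₁, z₁, hz₁, hd₁⟩ := exists_rareWord_append_eq h₁
  obtain ⟨w₁', x, hx, rfl⟩ := exists_rareWord_append_eq hz₁
  obtain ⟨w₂, z₂, hz₂, hd₂⟩ := exists_rareWord_append_eq h₂
  obtain ⟨w₂', y, hy, rfl⟩ := exists_rareWord_append_eq hz₂
  obtain rfl : joinRuns ((w₁, w₁'), (w₂, w₂')) (x, y) = d := Prod.ext hd₁ hd₂
  refine ⟨_, ?_, _, ⟨hx, hy, hunsplit.of_joinRuns⟩, rfl⟩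
  rintro ⟨s, hs⟩
  exact not_unsplittable_joinRuns_matchRuns s (hx.trans hy.symm) (hs ▸ hunsplit)

variable (o)

theorem balancedSum_add_two_le (g : A → ℝ≥0∞) (k : ℕ) :
    balancedSum o g (k + 2) ≤ freeRunsSum o g * balancedSum o g k := by
  have hparse : ∀ d : balancedPairs o (k + 2),
      ∃ e : ((Set.range matchRuns)ᶜ : Set (Runs o)) × balancedPairs o k,
        joinRuns e.1.1 e.2.1 = d.1 := fun d => by
    obtain ⟨Q, hQ, d', hd', h⟩ := exists_joinRuns_eq d.2
    exact ⟨(⟨Q, hQ⟩, ⟨d', hd'⟩), h⟩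
  choose parse hparse using hparse
  have hinj : Function.Injective parse := fun d d' h =>
    Subtype.ext (by rw [← hparse d, h, hparse d'])
  calc balancedSum o g (k + 2) = ∑' d, runsWt g (parse d).1.1 * pairWt g (parse d).2.1 :=
        tsum_congr fun d => by rw [← pairWt_joinRuns, hparse d]
    _ ≤ ∑' e : ((Set.range matchRuns)ᶜ : Set (Runs o)) × balancedPairs o k,
          runsWt g e.1.1 * pairWt g e.2.1 :=
        ENNReal.tsum_comp_le_tsum_of_injective hinj fun e => runsWt g e.1.1 * pairWt g e.2.1
    _ = freeRunsSum o g * balancedSum o g k := by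
        rw [freeRunsSum, balancedSum, ← tsum_prod_mul]

theorem balancedSum_two_mul_add_le (g : A → ℝ≥0∞) (i j : ℕ) :
    balancedSum o g (2 * j + i) ≤ freeRunsSum o g ^ j * balancedSum o g i := by
  induction j with
  | zero => simp
  | succ j ih =>
    calc balancedSum o g (2 * (j + 1) + i) = balancedSum o g (2 * j + i + 2) := by ring_nf
      _ ≤ freeRunsSum o g * (freeRunsSum o g ^ j * balancedSum o g i) :=
        (balancedSum_add_two_le o g _).trans (by gcongr)
      _ = freeRunsSum o g ^ (j + 1) * balancedSum o g i := by ring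

theorem tsum_balancedSum_le (g : A → ℝ≥0∞) :
    ∑' k, balancedSum o g k ≤
      (runSum o g ^ 2 + runSum o g ^ 4 * g o ^ 2) * (1 - freeRunsSum o g)⁻¹ := by
  calc ∑' k, balancedSum o g k
      = ∑' j, balancedSum o g (2 * j) + ∑' j, balancedSum o g (2 * j + 1) :=
        (tsum_even_add_odd ENNReal.summable ENNReal.summable).symm
    _ ≤ ∑' j, freeRunsSum o g ^ j * balancedSum o g 0 +
          ∑' j, freeRunsSum o g ^ j * balancedSum o g 1 := by
        gcongr with j j
        · exact balancedSum_two_mul_add_le o g 0 j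
        · exact balancedSum_two_mul_add_le o g 1 j
    _ ≤ ∑' j, freeRunsSum o g ^ j * (runSum o g * (runSum o g * g o) ^ 0) ^ 2 +
          ∑' j, freeRunsSum o g ^ j * (runSum o g * (runSum o g * g o) ^ 1) ^ 2 := by
        gcongr <;> exact balancedSum_le o g _
    _ = _ := by
        rw [ENNReal.tsum_mul_right, ENNReal.tsum_mul_right, ENNReal.tsum_geometric]
        ring

end BalancedPairs

section AlignmentWeights

variable {A : Type*} [DecidableEq A] {o : A}

variable (o) in
/-- The unsplittable pairs of words: the possible pairs of pieces of a refined alignment. -/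
abbrev Piece : Type _ := {d : List A × List A // Unsplittable o d.1 d.2}

/-- The contribution of a pair of pieces to the defect of an alignment. -/
def pieceDefect (o : A) (d : List A × List A) : ℕ :=
  gain o d.1 d.2 + gain o d.2 d.1 + Nat.dist (d.1.count o) (d.2.count o)

variable (o) in
/-- The weight of a pair of words as a pair of pieces of an alignment: a factor `τ` is paid for each
unit of the defect. -/
noncomputable def pieceWt (g : A → ℝ≥0∞) (τ : ℝ≥0∞) (d : List A × List A) : ℝ≥0∞ :=
  pairWt g d * τ ^ pieceDefect o d

variable (o) in
/-- The total weight of the unsplittable pairs of pieces. -/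
noncomputable def pieceSum (g : A → ℝ≥0∞) (τ : ℝ≥0∞) : ℝ≥0∞ :=
  ∑' d : Piece o, pieceWt o g τ d.1

variable (o) in
/-- The letter weights `g` with an additional factor `τ` for each rare letter. -/
noncomputable def tilt (g : A → ℝ≥0∞) (τ : ℝ≥0∞) (a : A) : ℝ≥0∞ := if a = o then g a else g a * τ

@[simp] theorem tilt_self (g : A → ℝ≥0∞) (τ : ℝ≥0∞) : tilt o g τ o = g o := if_pos rfl

@[simp] theorem tilt_one (g : A → ℝ≥0∞) : tilt o g 1 = g := by
  funext a
  simp [tilt]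

theorem wt_tilt (g : A → ℝ≥0∞) (τ : ℝ≥0∞) (x : List A) :
    wt (tilt o g τ) x = wt g x * τ ^ rares o x := by
  induction x with
  | nil => simp [rares]
  | cons a x ih =>
    by_cases h : a = o <;> simp only [rares] at ih <;> simp [rares, h, tilt, ih] <;> ring

theorem pieceWt_swap (g : A → ℝ≥0∞) (τ : ℝ≥0∞) (d : List A × List A) :
    pieceWt o g τ d.swap = pieceWt o g τ d := by
  simp only [pieceWt, pairWt, pieceDefect, Prod.fst_swap, Prod.snd_swap, Nat.dist_comm,
    mul_comm (wt g d.2), add_comm (gain o d.2 d.1)]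

theorem pieceWt_of_count_lt (g : A → ℝ≥0∞) (τ : ℝ≥0∞) {d : List A × List A}
    (h : d.1.count o < d.2.count o) : pieceWt o g τ d =
      wt (tilt o g τ) d.1 * wt g d.2 * τ ^ (d.2.count o - d.1.count o) := by
  rw [pieceWt, pairWt, pieceDefect, gain, gain, if_pos h, if_neg h.not_gt, wt_tilt,
    Nat.dist_eq_sub_of_le h.le]
  ring

theorem pieceWt_of_count_eq (g : A → ℝ≥0∞) (τ : ℝ≥0∞) {d : List A × List A}
    (h : d.1.count o = d.2.count o) : pieceWt o g τ d = pairWt g d := by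
  simp [pieceWt, pieceDefect, gain, h]

theorem pieceSum_le (g : A → ℝ≥0∞) (τ : ℝ≥0∞) : pieceSum o g τ ≤
    2 * unbalancedSum o (tilt o g τ) g τ + ∑' k, balancedSum o g k := by
  have hcover : {d | Unsplittable o d.1 d.2} ⊆
      unbalancedPairs o ∪ (Prod.swap ⁻¹' unbalancedPairs o ∪ ⋃ k, balancedPairs o k) := by
    intro d hd
    rcases lt_trichotomy (d.1.count o) (d.2.count o) with h | h | h
    · exact .inl h
    · exact .inr (.inr (Set.mem_iUnion.2 ⟨_, h, rfl, hd⟩))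
    · exact .inr (.inl h)
  have hlt : ∑' d : unbalancedPairs o, pieceWt o g τ d = unbalancedSum o (tilt o g τ) g τ :=
    tsum_congr fun d => pieceWt_of_count_lt g τ d.2
  have hgt : ∑' d : (Prod.swap ⁻¹' unbalancedPairs o : Set (List A × List A)), pieceWt o g τ d =
      unbalancedSum o (tilt o g τ) g τ := by
    rw [← hlt, ← ((Equiv.prodComm _ _).subtypeEquiv fun d => Iff.rfl :
      (Prod.swap ⁻¹' unbalancedPairs o : Set (List A × List A)) ≃ unbalancedPairs o).tsum_eq]
    exact tsum_congr fun d => (pieceWt_swap g τ d.1).symm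
  have heq : ∀ k, ∑' d : balancedPairs o k, pieceWt o g τ d = balancedSum o g k := fun k =>
    tsum_congr fun d => pieceWt_of_count_eq g τ (d.2.1.trans d.2.2.1.symm)
  calc pieceSum o g τ
      ≤ ∑' d : unbalancedPairs o, pieceWt o g τ d +
          (∑' d : (Prod.swap ⁻¹' unbalancedPairs o : Set (List A × List A)), pieceWt o g τ d +
            ∑' d : (⋃ k, balancedPairs o k), pieceWt o g τ d) :=
        (ENNReal.tsum_mono_subtype _ hcover).trans ((ENNReal.tsum_union_le _ _ _).trans
          (by gcongr; exact ENNReal.tsum_union_le _ _ _))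
    _ ≤ 2 * unbalancedSum o (tilt o g τ) g τ + ∑' k, balancedSum o g k := by
        rw [hlt, hgt, two_mul, add_assoc]
        simp only [← heq]
        gcongr
        exact ENNReal.tsum_iUnion_le_tsum _ _

namespace Alignment

/-- The weight of an alignment: the weight of the two words, with a factor `τ` for each unit of the
defect and a factor `t ^ 4` for each matched rare letter. -/
noncomputable def weight (g : A → ℝ≥0∞) (τ t : ℝ≥0∞) (π : Alignment o) : ℝ≥0∞ :=
  pairWt g (π.fst, π.snd) * (t ^ (4 * π.length) * τ ^ π.defect)

theorem weight_single (g : A → ℝ≥0∞) (τ t : ℝ≥0∞) (x y : List A) :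
    (single x y : Alignment o).weight g τ t = pieceWt o g τ (x, y) := by
  simp [weight, pieceWt, pieceDefect, defect, fst, snd, length, swap, gain, unmatched]

theorem weight_cons (g : A → ℝ≥0∞) (τ t : ℝ≥0∞) (x y : List A) (a : Rare o) (π : Alignment o) :
    (cons x y a π).weight g τ t =
      pieceWt o g τ (x, y) * (g a ^ 2 * t ^ 4) * π.weight g τ t := by
  simp only [weight, pieceWt, pairWt, pieceDefect, defect, fst, snd, length, swap, gain, unmatched,
    wt_append, wt_cons]
  ring

/-- The alignment with given pairs of pieces and given separating letters. -/
def ofPieces (L : List (Piece o × Rare o)) (f : Piece o) : Alignment o :=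
  L.foldr (fun c π => cons c.1.1.1 c.1.1.2 c.2 π) (single f.1.1 f.1.2)

theorem refined_ofPieces (L : List (Piece o × Rare o)) (f : Piece o) : (ofPieces L f).Refined := by
  induction L with
  | nil => exact f.2
  | cons c L ih => exact ⟨c.1.2, ih⟩

theorem exists_ofPieces_eq {π : Alignment o} (hπ : π.Refined) : ∃ L f, ofPieces L f = π := by
  induction π with
  | single x y => exact ⟨[], ⟨(x, y), hπ⟩, rfl⟩
  | cons x y a π ih =>
    obtain ⟨L, f, rfl⟩ := ih hπ.2
    exact ⟨(⟨(x, y), hπ.1⟩, a) :: L, f, rfl⟩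

theorem weight_ofPieces (g : A → ℝ≥0∞) (τ t : ℝ≥0∞) (L : List (Piece o × Rare o)) (f : Piece o) :
    (ofPieces L f).weight g τ t =
      (L.map fun c => pieceWt o g τ c.1 * (g c.2 ^ 2 * t ^ 4)).prod * pieceWt o g τ f := by
  induction L with
  | nil => simp [ofPieces, weight_single]
  | cons c L ih =>
    rw [List.map_cons, List.prod_cons, mul_assoc, ← ih]
    exact weight_cons ..

theorem tsum_weight_le [Fintype (Rare o)] (g : A → ℝ≥0∞) (τ t : ℝ≥0∞) :
    ∑' π : {π : Alignment o // π.Refined}, π.1.weight g τ t ≤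
      (1 - pieceSum o g τ * ((∑ a : Rare o, g a ^ 2) * t ^ 4))⁻¹ * pieceSum o g τ := by
  let glue (e : List (Piece o × Rare o) × Piece o) : {π : Alignment o // π.Refined} :=
    ⟨ofPieces e.1 e.2, refined_ofPieces e.1 e.2⟩
  have hglue : Function.Surjective glue := fun π => by
    obtain ⟨L, f, h⟩ := exists_ofPieces_eq π.2
    exact ⟨(L, f), Subtype.ext h⟩
  have hcell : ∑' c : Piece o × Rare o, pieceWt o g τ c.1 * (g c.2 ^ 2 * t ^ 4) =
      pieceSum o g τ * ((∑ a : Rare o, g a ^ 2) * t ^ 4) := by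
    rw [tsum_prod_mul (fun d : Piece o => pieceWt o g τ d) (fun a : Rare o => g a ^ 2 * t ^ 4),
      ENNReal.tsum_mul_right, tsum_fintype fun a : Rare o => g a ^ 2, pieceSum]
  refine (ENNReal.tsum_le_tsum_comp_of_surjective hglue _).trans_eq ?_
  rw [← hcell, ← tsum_prod_map_list, pieceSum, ← tsum_prod_mul]
  exact tsum_congr fun e => weight_ofPieces g τ t e.1 e.2

end Alignment

theorem exists_refined_pairWt_mul_le (o : A) (g : A → ℝ≥0∞) {τ t : ℝ≥0∞} (hτ : τ ≤ 1)
    (ht : t * τ = 1) {x y : List A} {E : ℕ}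
    (hE : flipSum o x y + |(x.count o : ℤ) - y.count o| ≤ E) :
    ∃ π : {π : Alignment o // π.Refined}, (π.1.fst, π.1.snd) = (x, y) ∧
      pairWt g (x, y) * τ ^ E ≤ π.1.weight g τ t := by
  obtain ⟨π, rfl, rfl, hopt, href⟩ := exists_isOptimal_refined o x y
  have hdefect : π.defect ≤ 4 * π.length + E := by
    have := hopt.defect_le
    omega
  refine ⟨⟨π, href⟩, rfl, ?_⟩
  rw [Alignment.weight]
  gcongr
  calc τ ^ E = (t * τ) ^ (4 * π.length) * τ ^ E := by rw [ht, one_pow, one_mul]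
    _ = t ^ (4 * π.length) * τ ^ (4 * π.length + E) := by ring
    _ ≤ t ^ (4 * π.length) * τ ^ π.defect := by
      gcongr t ^ _ * ?_
      exact pow_le_pow_of_le_one zero_le hτ hdefect

theorem tsum_pairWt_mul_le {o : A} (g : A → ℝ≥0∞) {τ t : ℝ≥0∞} (hτ : τ ≤ 1) (ht : t * τ = 1)
    {E : ℕ} (B : Set (List A × List A))
    (hB : ∀ d ∈ B, flipSum o d.1 d.2 + |(d.1.count o : ℤ) - d.2.count o| ≤ E) :
    (∑' d : B, pairWt g d) * τ ^ E ≤ ∑' π : {π : Alignment o // π.Refined}, π.1.weight g τ t := by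
  choose align halign hweight using fun d : B =>
    exists_refined_pairWt_mul_le o g hτ ht (hB d.1 d.2)
  have hinj : Function.Injective align := fun d e hde =>
    Subtype.ext ((halign d).symm.trans (hde ▸ halign e))
  rw [← ENNReal.tsum_mul_right]
  exact (ENNReal.tsum_le_tsum hweight).trans (ENNReal.tsum_comp_le_tsum_of_injective hinj _)

end AlignmentWeights

/-! ### Estimates for a dominant letter -/

section Estimates

variable {A : Type*} [Fintype A]

/-- The letter `o` has probability close to one, and `q` is the largest probability of the other
letters. -/
structure DominantLetter (p : A → ℝ) (o : A) (q : ℝ) : Prop where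
  nonneg : ∀ a, 0 ≤ p a
  sum_eq : ∑ a, p a = 1
  q_pos : 0 < q
  q_le : q ≤ 1 / 1000000
  le_q : ∀ a, a ≠ o → p a ≤ q
  exists_eq : ∃ a, a ≠ o ∧ p a = q
  large : 999 / 1000 ≤ p o

theorem one_add_pow_four_le {u : ℝ} (hu : 0 ≤ u) (hu1 : u ≤ 1 / 20) :
    (1 + u) ^ 4 ≤ 1 + 9 / 2 * u := by
  have hsq : u ^ 2 ≤ u / 20 := by nlinarith
  have hcube : u ^ 3 ≤ u / 400 := by nlinarith
  have hfour : u ^ 4 ≤ u / 400 := by nlinarith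
  linear_combination 6 * hsq + 4 * hcube + hfour + 3 / 16 * hu

/-- The letter weights `p a`, enlarged by a factor which exceeds one slightly. The total weight of
the pairs of words for which few letters change the longest common subsequence remains bounded for
these weights, so that the probability of such pairs decays exponentially. -/
noncomputable def growthWt (p : A → ℝ) (q : ℝ) (a : A) : ℝ≥0∞ :=
  ENNReal.ofReal (p a * (1 + q ^ 2 / 1000))

theorem inv_one_sub_le_ofReal_inv {x : ℝ≥0∞} {c : ℝ} (hc : 0 < c) (hc1 : c ≤ 1)
    (hx : x ≤ ENNReal.ofReal (1 - c)) : (1 - x)⁻¹ ≤ ENNReal.ofReal c⁻¹ := by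
  rw [ENNReal.ofReal_inv_of_pos hc, ENNReal.inv_le_inv]
  calc ENNReal.ofReal c = 1 - ENNReal.ofReal (1 - c) := by
        rw [← ENNReal.ofReal_one, ← ENNReal.ofReal_sub _ (sub_nonneg.2 hc1), sub_sub_cancel]
    _ ≤ 1 - x := tsub_le_tsub_left hx 1

namespace DominantLetter

variable {p : A → ℝ} {o : A} {q : ℝ}

theorem sum_rare [DecidableEq A] (h : DominantLetter p o q) :
    ∑ a : Rare o, p a = 1 - p o := by
  rw [← h.sum_eq, Fintype.sum_eq_add_sum_subtype_ne p o]
  ring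

theorem q_le_one_sub (h : DominantLetter p o q) : q ≤ 1 - p o := by
  classical
  obtain ⟨a, ha, rfl⟩ := h.exists_eq
  rw [← h.sum_rare]
  exact Finset.single_le_sum (f := fun a : Rare o => p a) (fun a _ => h.nonneg a)
    (Finset.mem_univ ⟨a, ha⟩)

theorem one_sub_pos (h : DominantLetter p o q) : 0 < 1 - p o := h.q_pos.trans_le h.q_le_one_sub

theorem q_sq_le (h : DominantLetter p o q) : q ^ 2 ≤ (1 - p o) / 1000000 := by
  rw [sq, div_eq_mul_one_div, mul_comm]
  exact mul_le_mul h.q_le_one_sub h.q_le h.q_pos.le h.one_sub_pos.le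

theorem one_sub_mul_growth_le (h : DominantLetter p o q) :
    (1 - p o) * (1 + q ^ 2 / 1000) ≤ 1001 / 1000000 := by
  nlinarith [h.q_sq_le, h.large, h.one_sub_pos]

theorem growthWt_self_le_one (h : DominantLetter p o q) : growthWt p q o ≤ 1 := by
  rw [growthWt, ENNReal.ofReal_le_one]
  nlinarith [h.q_sq_le, h.q_pos, h.large]

variable [DecidableEq A]

theorem sq_le_sum_sq (h : DominantLetter p o q) : q ^ 2 ≤ ∑ a : Rare o, p a ^ 2 := by
  obtain ⟨a, ha, rfl⟩ := h.exists_eq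
  exact Finset.single_le_sum (f := fun a : Rare o => p a ^ 2) (fun a _ => sq_nonneg _)
    (Finset.mem_univ ⟨a, ha⟩)

theorem sum_sq_pos (h : DominantLetter p o q) : 0 < ∑ a : Rare o, p a ^ 2 :=
  (pow_pos h.q_pos 2).trans_le h.sq_le_sum_sq

theorem sum_sq_le (h : DominantLetter p o q) : ∑ a : Rare o, p a ^ 2 ≤ q * (1 - p o) := by
  rw [← h.sum_rare, Finset.mul_sum]
  gcongr with a
  rw [sq]
  exact mul_le_mul_of_nonneg_right (h.le_q a a.2) (h.nonneg a)

theorem sum_growthWt (h : DominantLetter p o q) :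
    ∑ a : Rare o, growthWt p q a = ENNReal.ofReal ((1 - p o) * (1 + q ^ 2 / 1000)) := by
  rw [← h.sum_rare, Finset.sum_mul, ENNReal.ofReal_sum_of_nonneg]
  · rfl
  · exact fun a _ => mul_nonneg (h.nonneg a) (by positivity)

theorem sum_growthWt_sq (h : DominantLetter p o q) : ∑ a : Rare o, growthWt p q a ^ 2 =
    ENNReal.ofReal ((∑ a : Rare o, p a ^ 2) * (1 + q ^ 2 / 1000) ^ 2) := by
  rw [Finset.sum_mul, ENNReal.ofReal_sum_of_nonneg fun a _ => by positivity]
  refine Finset.sum_congr rfl fun a _ => ?_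
  rw [growthWt, ← ENNReal.ofReal_pow (mul_nonneg (h.nonneg a) (by positivity)), mul_pow]

theorem sum_tilt_growthWt (h : DominantLetter p o q) {c : ℝ} (hc : 0 ≤ c) :
    ∑ a : Rare o, tilt o (growthWt p q) (ENNReal.ofReal c) a =
      ENNReal.ofReal (c * ((1 - p o) * (1 + q ^ 2 / 1000))) := by
  rw [ENNReal.ofReal_mul hc, ← h.sum_growthWt, Finset.mul_sum]
  exact Finset.sum_congr rfl fun a _ => by rw [tilt, if_neg a.2, mul_comm]

theorem runSum_tilt_growthWt_le (h : DominantLetter p o q) {c : ℝ} (hc : 0 ≤ c) (hc1 : c ≤ 1) :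
    runSum o (tilt o (growthWt p q) (ENNReal.ofReal c)) ≤
      ENNReal.ofReal (1 - c * ((1 - p o) * (1 + q ^ 2 / 1000)))⁻¹ := by
  have hpos : 0 ≤ (1 - p o) * (1 + q ^ 2 / 1000) := mul_nonneg h.one_sub_pos.le (by positivity)
  have hle := h.one_sub_mul_growth_le
  rw [runSum_eq, tsum_fintype, h.sum_tilt_growthWt hc]
  exact inv_one_sub_le_ofReal_inv (by nlinarith) (by nlinarith) (by rw [sub_sub_cancel])

theorem runSum_tilt_growthWt_le_const (h : DominantLetter p o q) {c : ℝ} (hc : 0 ≤ c)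
    (hc1 : c ≤ 1) :
    runSum o (tilt o (growthWt p q) (ENNReal.ofReal c)) ≤ ENNReal.ofReal (1002 / 1000) := by
  have hle := h.one_sub_mul_growth_le
  refine (h.runSum_tilt_growthWt_le hc hc1).trans (ENNReal.ofReal_le_ofReal ?_)
  calc _ ≤ (1000 / 1002 : ℝ)⁻¹ := by gcongr; nlinarith
    _ = 1002 / 1000 := inv_div ..

theorem runSum_tilt_growthWt_mul_le (h : DominantLetter p o q) {c b : ℝ} (hc : 0 ≤ c) (hc1 : c ≤ 1)
    (hb : p o * (1 + q ^ 2 / 1000) ≤ b * (1 - c * ((1 - p o) * (1 + q ^ 2 / 1000)))) :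
    runSum o (tilt o (growthWt p q) (ENNReal.ofReal c)) * growthWt p q o ≤ ENNReal.ofReal b := by
  have hone : 0 < 1 - c * ((1 - p o) * (1 + q ^ 2 / 1000)) := by
    nlinarith [h.one_sub_mul_growth_le]
  calc _ ≤ ENNReal.ofReal (1 - c * ((1 - p o) * (1 + q ^ 2 / 1000)))⁻¹ *
        ENNReal.ofReal (p o * (1 + q ^ 2 / 1000)) := by
        gcongr
        · exact h.runSum_tilt_growthWt_le hc hc1
        · exact le_rfl
    _ = ENNReal.ofReal ((1 - c * ((1 - p o) * (1 + q ^ 2 / 1000)))⁻¹ *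
        (p o * (1 + q ^ 2 / 1000))) := (ENNReal.ofReal_mul (by positivity)).symm
    _ ≤ ENNReal.ofReal b := by
        gcongr
        rwa [inv_mul_le_iff₀' hone]

omit [DecidableEq A] in
theorem runSum_growthWt_le (h : DominantLetter p o q) :
    runSum o (growthWt p q) ≤ ENNReal.ofReal (1002 / 1000) := by
  classical
  simpa using h.runSum_tilt_growthWt_le_const zero_le_one le_rfl

omit [DecidableEq A] in
theorem runSum_growthWt_mul_le (h : DominantLetter p o q) :
    runSum o (growthWt p q) * growthWt p q o ≤ ENNReal.ofReal (1 + q ^ 2 / 500) := by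
  classical
  have hle := h.one_sub_mul_growth_le
  have := h.runSum_tilt_growthWt_mul_le (c := 1) (b := 1 + q ^ 2 / 500) zero_le_one le_rfl
    (by nlinarith [mul_nonneg (sq_nonneg q) (sub_nonneg.2 hle)])
  simpa using this

theorem runSum_damped_mul_le (h : DominantLetter p o q) :
    runSum o (tilt o (growthWt p q) (ENNReal.ofReal (20 / 21))) * growthWt p q o ≤
      ENNReal.ofReal (1 - (1 - p o) / 22) := by
  have hsq := h.q_sq_le
  have hpos := h.one_sub_pos
  have hgrowth : 1 - p o ≤ (1 - p o) * (1 + q ^ 2 / 1000) :=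
    le_mul_of_one_le_right hpos.le (le_add_of_nonneg_right (by positivity))
  refine h.runSum_tilt_growthWt_mul_le (by norm_num) (by norm_num) ?_
  nlinarith [mul_nonneg hpos.le (hpos.le.trans hgrowth)]

theorem unbalancedSum_growthWt_le (h : DominantLetter p o q) :
    unbalancedSum o (tilt o (growthWt p q) (ENNReal.ofReal (20 / 21))) (growthWt p q)
      (ENNReal.ofReal (20 / 21)) ≤ ENNReal.ofReal (528 / (1 - p o)) := by
  have hpos := h.one_sub_pos
  have hlarge := h.large
  have hsq := h.q_sq_le
  have hboth : runSum o (tilt o (growthWt p q) (ENNReal.ofReal (20 / 21))) * growthWt p q o *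
      (runSum o (growthWt p q) * growthWt p q o) ≤ ENNReal.ofReal (1 - (1 - p o) / 25) := by
    refine (mul_le_mul' h.runSum_damped_mul_le h.runSum_growthWt_mul_le).trans ?_
    rw [← ENNReal.ofReal_mul (by linarith)]
    exact ENNReal.ofReal_le_ofReal (by nlinarith [sq_nonneg q])
  have hexcess : runSum o (growthWt p q) * growthWt p q o * ENNReal.ofReal (20 / 21) ≤
      ENNReal.ofReal (1 - 1 / 22) := by
    refine (mul_le_mul_left h.runSum_growthWt_mul_le _).trans ?_
    rw [← ENNReal.ofReal_mul (by positivity)]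
    exact ENNReal.ofReal_le_ofReal (by linarith)
  refine (unbalancedSum_le o _ _ _).trans ?_
  rw [tilt_self]
  calc _ ≤ ENNReal.ofReal (1002 / 1000) * ENNReal.ofReal (1002 / 1000) *
        ENNReal.ofReal ((1 - p o) / 25)⁻¹ *
        (ENNReal.ofReal (1 - 1 / 22) * ENNReal.ofReal (1 / 22)⁻¹) := by
        gcongr
        · exact h.runSum_tilt_growthWt_le_const (by norm_num) (by norm_num)
        · exact h.runSum_growthWt_le
        · exact inv_one_sub_le_ofReal_inv (by linarith) (by linarith) hboth
        · exact inv_one_sub_le_ofReal_inv (by norm_num) (by norm_num) hexcess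
    _ = ENNReal.ofReal (1002 / 1000 * (1002 / 1000) * ((1 - p o) / 25)⁻¹ *
        ((1 - 1 / 22) * (1 / 22)⁻¹)) := by
        rw [ENNReal.ofReal_mul (by positivity), ENNReal.ofReal_mul (by positivity),
          ENNReal.ofReal_mul (by positivity), ENNReal.ofReal_mul (by norm_num)]
    _ ≤ ENNReal.ofReal (528 / (1 - p o)) := by
        gcongr
        rw [inv_div, ← mul_div_assoc, div_mul_eq_mul_div]
        gcongr
        norm_num

theorem freeRunsSum_growthWt_le (h : DominantLetter p o q) : freeRunsSum o (growthWt p q) ≤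
    ENNReal.ofReal (1 - 296 / 100 * ∑ a : Rare o, p a ^ 2) := by
  have hadd := freeRunsSum_add (o := o) (growthWt p q)
  rw [h.sum_growthWt_sq] at hadd
  have hs := h.sum_sq_pos.le
  have hqs := h.sq_le_sum_sq
  set s := ∑ a : Rare o, p a ^ 2
  have hruns : (runSum o (growthWt p q) * growthWt p q o) ^ 4 ≤
      ENNReal.ofReal (1 + 9 / 1000 * q ^ 2) := by
    calc _ ≤ ENNReal.ofReal (1 + q ^ 2 / 500) ^ 4 := by gcongr; exact h.runSum_growthWt_mul_le
      _ = ENNReal.ofReal ((1 + q ^ 2 / 500) ^ 4) := (ENNReal.ofReal_pow (by positivity) _).symm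
      _ ≤ _ := by
        refine ENNReal.ofReal_le_ofReal
          ((one_add_pow_four_le (by positivity) ?_).trans_eq (by ring))
        linarith [h.q_sq_le, h.large]
  have hmatch : ENNReal.ofReal (2969 / 1000 * s) ≤
      3 * ENNReal.ofReal (s * (1 + q ^ 2 / 1000) ^ 2) * growthWt p q o ^ 4 := by
    have hgrowth : (1 : ℝ) ≤ 1 + q ^ 2 / 1000 := le_add_of_nonneg_right (by positivity)
    have hpo : 999 / 1000 ≤ p o * (1 + q ^ 2 / 1000) :=
      h.large.trans (le_mul_of_one_le_right (h.nonneg o) hgrowth)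
    calc ENNReal.ofReal (2969 / 1000 * s)
        ≤ ENNReal.ofReal (3 * (s * 1 ^ 2) * (999 / 1000) ^ 4) :=
          ENNReal.ofReal_le_ofReal (by linarith)
      _ = 3 * ENNReal.ofReal (s * 1 ^ 2) * ENNReal.ofReal (999 / 1000) ^ 4 := by
        rw [ENNReal.ofReal_mul (by positivity), ENNReal.ofReal_mul (by norm_num),
          ENNReal.ofReal_pow (by norm_num), ENNReal.ofReal_ofNat]
      _ ≤ 3 * ENNReal.ofReal (s * (1 + q ^ 2 / 1000) ^ 2) * growthWt p q o ^ 4 := by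
        rw [growthWt]
        gcongr
  calc freeRunsSum o (growthWt p q)
      ≤ ENNReal.ofReal (1 + 9 / 1000 * q ^ 2) - ENNReal.ofReal (2969 / 1000 * s) :=
        ENNReal.le_sub_of_add_le_right ENNReal.ofReal_ne_top
          ((add_le_add_right hmatch _).trans (hadd.trans_le hruns))
    _ = ENNReal.ofReal (1 + 9 / 1000 * q ^ 2 - 2969 / 1000 * s) :=
        (ENNReal.ofReal_sub _ (by positivity)).symm
    _ ≤ ENNReal.ofReal (1 - 296 / 100 * s) := ENNReal.ofReal_le_ofReal (by linarith)

theorem tsum_balancedSum_growthWt_le (h : DominantLetter p o q) :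
    ∑' k, balancedSum o (growthWt p q) k ≤
      ENNReal.ofReal (69 / 100 / ∑ a : Rare o, p a ^ 2) := by
  have hs := h.sum_sq_pos
  have hs1 : 296 / 100 * ∑ a : Rare o, p a ^ 2 ≤ 1 := by
    nlinarith [h.sum_sq_le, h.q_le, h.large, h.one_sub_pos]
  calc _ ≤ (ENNReal.ofReal (1002 / 1000) ^ 2 + ENNReal.ofReal (1002 / 1000) ^ 4 * 1 ^ 2) *
        ENNReal.ofReal (296 / 100 * ∑ a : Rare o, p a ^ 2)⁻¹ := by
        refine (tsum_balancedSum_le o _).trans ?_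
        gcongr
        · exact h.runSum_growthWt_le
        · exact h.runSum_growthWt_le
        · exact h.growthWt_self_le_one
        · exact inv_one_sub_le_ofReal_inv (by positivity) hs1 h.freeRunsSum_growthWt_le
    _ = ENNReal.ofReal (((1002 / 1000) ^ 2 + (1002 / 1000) ^ 4) *
        (296 / 100 * ∑ a : Rare o, p a ^ 2)⁻¹) := by
        rw [ENNReal.ofReal_mul (by positivity), ENNReal.ofReal_add (by positivity) (by positivity),
          ENNReal.ofReal_pow (by positivity), ENNReal.ofReal_pow (by positivity), one_pow, mul_one]
    _ ≤ ENNReal.ofReal (69 / 100 / ∑ a : Rare o, p a ^ 2) := by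
        gcongr
        rw [mul_inv, ← mul_assoc, ← div_eq_mul_inv _ (∑ a : Rare o, p a ^ 2)]
        gcongr
        norm_num

theorem pieceSum_growthWt_le (h : DominantLetter p o q) :
    pieceSum o (growthWt p q) (ENNReal.ofReal (20 / 21)) ≤
      ENNReal.ofReal (70 / 100 / ∑ a : Rare o, p a ^ 2) := by
  have hpos := h.one_sub_pos
  have hs := h.sum_sq_pos
  have hle := h.sum_sq_le
  refine (pieceSum_le _ _).trans ((add_le_add (mul_le_mul_right h.unbalancedSum_growthWt_le 2)
    h.tsum_balancedSum_growthWt_le).trans ?_)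
  set s := ∑ a : Rare o, p a ^ 2
  calc 2 * ENNReal.ofReal (528 / (1 - p o)) + ENNReal.ofReal (69 / 100 / s)
      = ENNReal.ofReal (2 * (528 / (1 - p o)) + 69 / 100 / s) := by
        rw [ENNReal.ofReal_add (by positivity) (by positivity), ENNReal.ofReal_mul (by norm_num),
          ENNReal.ofReal_ofNat]
    _ ≤ ENNReal.ofReal (70 / 100 / s) := by
        refine ENNReal.ofReal_le_ofReal ?_
        have hsq : s / (1 - p o) ≤ q := (div_le_iff₀ hpos).2 hle
        rw [le_div_iff₀ hs, add_mul, div_mul_cancel₀ _ hs.ne']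
        calc _ = 1056 * (s / (1 - p o)) + 69 / 100 := by ring
          _ ≤ 70 / 100 := by linarith [h.q_le]

theorem cellSum_growthWt_le (h : DominantLetter p o q) :
    pieceSum o (growthWt p q) (ENNReal.ofReal (20 / 21)) *
        ((∑ a : Rare o, growthWt p q a ^ 2) * ENNReal.ofReal (21 / 20) ^ 4) ≤
      ENNReal.ofReal (1 - 1 / 20) := by
  have hs := h.sum_sq_pos
  have hgrowth : (1 + q ^ 2 / 1000) ^ 2 ≤ 101 / 100 := by
    nlinarith [h.q_sq_le, h.large, sq_nonneg q]
  rw [h.sum_growthWt_sq]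
  refine (mul_le_mul_left h.pieceSum_growthWt_le _).trans ?_
  rw [← ENNReal.ofReal_pow (by positivity), ← ENNReal.ofReal_mul (by positivity),
    ← ENNReal.ofReal_mul (by positivity), ← mul_assoc, ← mul_assoc, div_mul_cancel₀ _ hs.ne']
  refine ENNReal.ofReal_le_ofReal ?_
  calc (70 / 100 * (1 + q ^ 2 / 1000) ^ 2 * (21 / 20) ^ 4 : ℝ)
      ≤ 70 / 100 * (101 / 100) * (21 / 20) ^ 4 := by gcongr
    _ ≤ 1 - 1 / 20 := by norm_num

theorem tsum_weight_growthWt_le (h : DominantLetter p o q) :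
    ∑' π : {π : Alignment o // π.Refined},
        π.1.weight (growthWt p q) (ENNReal.ofReal (20 / 21)) (ENNReal.ofReal (21 / 20)) ≤
      ENNReal.ofReal (20 / q ^ 2) := by
  have hq := h.q_pos
  calc _ ≤ ENNReal.ofReal (1 / 20)⁻¹ * ENNReal.ofReal (70 / 100 / ∑ a : Rare o, p a ^ 2) := by
        refine (Alignment.tsum_weight_le _ _ _).trans ?_
        gcongr
        · exact inv_one_sub_le_ofReal_inv (by norm_num) (by norm_num) h.cellSum_growthWt_le
        · exact h.pieceSum_growthWt_le
    _ = ENNReal.ofReal ((1 / 20)⁻¹ * (70 / 100 / ∑ a : Rare o, p a ^ 2)) :=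
        (ENNReal.ofReal_mul (by norm_num)).symm
    _ ≤ ENNReal.ofReal (20 / q ^ 2) := by
        refine ENNReal.ofReal_le_ofReal ?_
        rw [one_div, inv_inv, ← mul_div_assoc]
        gcongr
        · norm_num
        · exact h.sq_le_sum_sq

end DominantLetter

end Estimates

/-! ### Discrete integration by parts -/

section RareCount

variable {ι A : Type*} [Fintype ι] [DecidableEq A]

/-- The number of coordinates of `s` different from `o`. It is real-valued because it enters
moment computations. -/
def rareCount (o : A) (s : ι → A) : ℝ := ∑ i, if s i ≠ o then 1 else 0

theorem rareCount_nonneg (o : A) (s : ι → A) : 0 ≤ rareCount o s :=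
  Finset.sum_nonneg fun i _ => by split_ifs <;> norm_num

theorem rareCount_le (o : A) (s : ι → A) : rareCount o s ≤ Fintype.card ι := by
  calc rareCount o s ≤ ∑ _ : ι, (1 : ℝ) :=
        Finset.sum_le_sum fun i _ => by split_ifs <;> norm_num
    _ = Fintype.card ι := by simp

theorem card_sub_rareCount (o : A) (s : ι → A) :
    Fintype.card ι - rareCount o s = ∑ i, if s i = o then 1 else 0 := by
  have hcard : (Fintype.card ι : ℝ) = ∑ i : ι, 1 := by simp
  rw [hcard, rareCount, ← Finset.sum_sub_distrib]
  refine Finset.sum_congr rfl fun i _ => ?_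
  by_cases h : s i = o <;> simp [h]

theorem rareCount_update [DecidableEq ι] (o : A) (s : ι → A) (i : ι) (h : s i ≠ o) :
    rareCount o (Function.update s i o) = rareCount o s - 1 := by
  have hrest : ∀ j ∈ Finset.univ.erase i,
      (if Function.update s i o j ≠ o then (1 : ℝ) else 0) = if s j ≠ o then 1 else 0 := by
    intro j hj
    rw [Function.update_of_ne (Finset.ne_of_mem_erase hj)]
  rw [rareCount, rareCount, ← Finset.add_sum_erase _ _ (Finset.mem_univ i),
    ← Finset.add_sum_erase Finset.univ (fun j => if s j ≠ o then (1 : ℝ) else 0)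
      (Finset.mem_univ i), Finset.sum_congr rfl hrest]
  simp [h]

end RareCount

section Expectation

variable {ι A : Type*} [Fintype ι] [DecidableEq ι] [Fintype A]

/-- The expectation of `F s` when the coordinates of `s` are independent and take each value `a`
with probability `p a`. -/
noncomputable def mean (p : A → ℝ) (F : (ι → A) → ℝ) : ℝ := ∑ s : ι → A, (∏ i, p (s i)) * F s

variable {p : A → ℝ}

theorem mean_add (F G : (ι → A) → ℝ) :
    mean p (fun s => F s + G s) = mean p F + mean p G := by
  simp [mean, mul_add, Finset.sum_add_distrib]

theorem mean_sub (F G : (ι → A) → ℝ) :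
    mean p (fun s => F s - G s) = mean p F - mean p G := by
  simp [mean, mul_sub, Finset.sum_sub_distrib]

theorem mean_const_mul (c : ℝ) (F : (ι → A) → ℝ) :
    mean p (fun s => c * F s) = c * mean p F := by
  simp only [mean, Finset.mul_sum]
  exact Finset.sum_congr rfl fun s _ => by ring

theorem mean_sum {κ : Type*} (t : Finset κ) (F : κ → (ι → A) → ℝ) :
    mean p (fun s => ∑ k ∈ t, F k s) = ∑ k ∈ t, mean p (F k) := by
  simp only [mean, Finset.mul_sum]
  exact Finset.sum_comm

theorem mean_mono (hp : ∀ a, 0 ≤ p a) {F G : (ι → A) → ℝ} (h : ∀ s, F s ≤ G s) :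
    mean p F ≤ mean p G :=
  Finset.sum_le_sum fun s _ =>
    mul_le_mul_of_nonneg_left (h s) (Finset.prod_nonneg fun i _ => hp (s i))

theorem sum_prod_eq_one (hp : ∑ a, p a = 1) : ∑ s : ι → A, ∏ i, p (s i) = 1 := by
  rw [← Fintype.piFinset_univ, ← Finset.prod_univ_sum (fun _ => Finset.univ) fun _ a => p a]
  simp [hp]

theorem mean_const (hp : ∑ a, p a = 1) (c : ℝ) : mean p (fun _ : ι → A => c) = c := by
  rw [mean, ← Finset.sum_mul, sum_prod_eq_one hp, one_mul]

omit [Fintype A] in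
theorem prod_update_mul (p : A → ℝ) (s : ι → A) (i : ι) (a : A) :
    (∏ j, p (Function.update s i a j)) * p (s i) = (∏ j, p (s j)) * p a := by
  simp only [Function.apply_update fun _ => p]
  rw [Finset.prod_update_of_mem (Finset.mem_univ i),
    ← Finset.mul_prod_erase Finset.univ (fun j => p (s j)) (Finset.mem_univ i),
    Finset.sdiff_singleton_eq_erase]
  ring

theorem mean_resample (hp : ∑ a, p a = 1) (i : ι) (F : (ι → A) → ℝ) :
    mean p F = mean p (fun s => ∑ a, p a * F (Function.update s i a)) := by
  let swap : (ι → A) × A ≃ (ι → A) × A :=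
    { toFun := fun d => (Function.update d.1 i d.2, d.1 i)
      invFun := fun d => (Function.update d.1 i d.2, d.1 i)
      left_inv := fun d => by simp
      right_inv := fun d => by simp }
  calc mean p F = ∑ d : (ι → A) × A, (∏ j, p (d.1 j)) * p d.2 * F d.1 := by
        rw [Fintype.sum_prod_type, mean]
        refine Finset.sum_congr rfl fun s _ => ?_
        dsimp only
        rw [← Finset.sum_mul, ← Finset.mul_sum, hp, mul_one]
    _ = ∑ d : (ι → A) × A, (∏ j, p (d.1 j)) * p d.2 * F (Function.update d.1 i d.2) := by
        rw [← swap.sum_comp]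
        refine Finset.sum_congr rfl fun d _ => ?_
        simp only [swap, Equiv.coe_fn_mk, prod_update_mul]
    _ = mean p (fun s => ∑ a, p a * F (Function.update s i a)) := by
        rw [Fintype.sum_prod_type, mean]
        simp only [Finset.mul_sum, mul_assoc]

theorem mean_mul_eq_zero (hp : ∑ a, p a = 1) (i : ι) (u : A → ℝ) (hu : ∑ a, p a * u a = 0)
    (G : (ι → A) → ℝ) (hG : ∀ s a, G (Function.update s i a) = G s) :
    mean p (fun s => u (s i) * G s) = 0 := by
  rw [mean_resample hp i]
  simp only [Function.update_self, hG, ← mul_assoc, ← Finset.sum_mul, hu, zero_mul]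
  exact mean_const hp 0

theorem mean_coord (hp : ∑ a, p a = 1) (i : ι) (u : A → ℝ) :
    mean p (fun s => u (s i)) = ∑ a, p a * u a := by
  rw [mean_resample hp i]
  simp only [Function.update_self]
  exact mean_const hp _

theorem mean_sq_sum (hp : ∑ a, p a = 1) (u : A → ℝ) (hu : ∑ a, p a * u a = 0) (c : ι → ℝ) :
    mean p (fun s => (∑ i, c i * u (s i)) ^ 2) = (∑ i, c i ^ 2) * ∑ a, p a * u a ^ 2 := by
  have hsq (s : ι → A) : (∑ i, c i * u (s i)) ^ 2 =
      ∑ i, ∑ j, c i * c j * (u (s i) * u (s j)) := by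
    rw [sq, Finset.sum_mul_sum]
    exact Finset.sum_congr rfl fun i _ => Finset.sum_congr rfl fun j _ => by ring
  simp only [hsq, mean_sum, mean_const_mul]
  rw [Finset.sum_mul]
  refine Finset.sum_congr rfl fun i _ => ?_
  rw [Finset.sum_eq_single i]
  · simp only [← sq]
    rw [mean_coord hp i fun a => u a ^ 2]
  · intro j _ hj
    rw [mean_mul_eq_zero hp i u hu (fun s => u (s j)), mul_zero]
    exact fun s a => by rw [Function.update_of_ne hj]
  · simp

open Classical in
/-- The probability of the event `P` under the law of independent coordinates with distribution
`p`. -/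
noncomputable def prob (p : A → ℝ) (P : (ι → A) → Prop) : ℝ := mean p fun s => if P s then 1 else 0

theorem prob_nonneg (hp : ∀ a, 0 ≤ p a) (P : (ι → A) → Prop) : 0 ≤ prob p P :=
  Finset.sum_nonneg fun s _ => mul_nonneg (Finset.prod_nonneg fun i _ => hp (s i))
    (by
    dsimp only
    split_ifs <;> norm_num)

theorem prob_mono (hp : ∀ a, 0 ≤ p a) {P Q : (ι → A) → Prop} (h : ∀ s, P s → Q s) :
    prob p P ≤ prob p Q := by
  refine mean_mono hp fun s => ?_
  by_cases hP : P s
  · rw [if_pos hP, if_pos (h s hP)]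
  · rw [if_neg hP]
    split_ifs <;> norm_num

theorem prob_or_le (hp : ∀ a, 0 ≤ p a) (P Q : (ι → A) → Prop) :
    prob p (fun s => P s ∨ Q s) ≤ prob p P + prob p Q := by
  rw [prob, prob, prob, ← mean_add]
  refine mean_mono hp fun s => ?_
  by_cases hP : P s <;> by_cases hQ : Q s <;> simp [hP, hQ]

theorem prob_lt_abs_le (hp : ∀ a, 0 ≤ p a) (W : (ι → A) → ℝ) {b : ℝ} (hb : 0 < b) :
    prob p (fun s => b < |W s|) ≤ mean p (fun s => W s ^ 2) / b ^ 2 := by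
  rw [div_eq_inv_mul, ← mean_const_mul]
  refine mean_mono hp fun s => ?_
  split_ifs with h
  · rw [← div_eq_inv_mul, le_div_iff₀ (by positivity), one_mul, ← sq_abs (W s)]
    exact pow_le_pow_left₀ hb.le h.le 2
  · positivity

end Expectation

section IntegrationByParts

variable {ι A : Type*} [Fintype ι] [DecidableEq ι] [DecidableEq A]

/-- The sum of the changes of `f` when a single coordinate different from `o` is set to `o`. -/
def changeSum (o : A) (f : (ι → A) → ℝ) (s : ι → A) : ℝ :=
  ∑ i, if s i ≠ o then f (Function.update s i o) - f s else 0

variable [Fintype A] {p : A → ℝ}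

theorem sum_rare_mul (hp : ∑ a, p a = 1) (o : A) :
    ∑ a, p a * (if a ≠ o then 1 else 0) = 1 - p o := by
  have hsplit (a : A) : p a * (if a ≠ o then 1 else 0) = p a - if a = o then p o else 0 := by
    by_cases h : a = o <;> simp [h]
  simp only [hsplit, Finset.sum_sub_distrib, hp, Finset.sum_ite_eq', Finset.mem_univ, if_true]

theorem mean_flip (hp : ∑ a, p a = 1) (o : A) (H : (ι → A) → ℝ) :
    p o * mean p (fun s => ∑ i, if s i ≠ o then H (Function.update s i o) else 0) =
      (1 - p o) * mean p (fun s => (Fintype.card ι - rareCount o s) * H s) := by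
  simp only [card_sub_rareCount, Finset.sum_mul, ite_mul, one_mul, zero_mul, mean_sum,
    Finset.mul_sum]
  refine Finset.sum_congr rfl fun i _ => ?_
  rw [mean_resample hp i, mean_resample hp i fun s => if s i = o then H s else 0]
  simp only [Function.update_self, Function.update_idem]
  have hrare (s : ι → A) : ∑ a, p a * (if a ≠ o then H (Function.update s i o) else 0) =
      (1 - p o) * H (Function.update s i o) := by
    rw [← sum_rare_mul hp o, Finset.sum_mul]
    simp only [mul_assoc, ite_mul, one_mul, zero_mul]
  have hdominant (s : ι → A) : ∑ a, p a * (if a = o then H (Function.update s i a) else 0) =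
      p o * H (Function.update s i o) := by simp
  simp only [hrare, hdominant, mean_const_mul]
  ring

theorem mean_changeSum (hp : ∑ a, p a = 1) (o : A) (f : (ι → A) → ℝ) (ψ : ℝ → ℝ) :
    p o * mean p (fun s => ψ (rareCount o s - 1) * changeSum o f s) =
      mean p (fun s => (f s - mean p f) * ((1 - p o) * (Fintype.card ι - rareCount o s) *
        ψ (rareCount o s) - p o * rareCount o s * ψ (rareCount o s - 1))) := by
  have hflip := mean_flip hp o fun s => ψ (rareCount o s) * (f s - mean p f)
  have hchange (s : ι → A) : (∑ i, if s i ≠ o then ψ (rareCount o (Function.update s i o)) *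
      (f (Function.update s i o) - mean p f) else 0) =
      ψ (rareCount o s - 1) * changeSum o f s +
        rareCount o s * (ψ (rareCount o s - 1) * (f s - mean p f)) := by
    rw [changeSum, Finset.mul_sum]
    conv_rhs => rw [rareCount, Finset.sum_mul, ← rareCount, ← Finset.sum_add_distrib]
    refine Finset.sum_congr rfl fun i _ => ?_
    split_ifs with hi
    · rw [rareCount_update o s i hi]; ring
    · simp
  simp only [hchange, mean_add] at hflip
  rw [mul_add, ← mean_const_mul (p o) fun s => rareCount o s *
    (ψ (rareCount o s - 1) * (f s - mean p f)), ← mean_const_mul (1 - p o)] at hflip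
  rw [eq_sub_of_add_eq hflip, ← mean_sub]
  congr 1
  ext s
  ring

end IntegrationByParts

section Tent

/-- The tent function with peak one at `c` and support `[c - l, c + l]`. -/
noncomputable def tent (c l t : ℝ) : ℝ := max 0 (1 - |t - c| / l)

variable {c l : ℝ}

theorem tent_nonneg (c l t : ℝ) : 0 ≤ tent c l t := le_max_left _ _

theorem tent_le_one (hl : 0 < l) (t : ℝ) : tent c l t ≤ 1 :=
  max_le zero_le_one (sub_le_self _ (by positivity))

theorem abs_mul_tent_le (hl : 0 < l) (t : ℝ) : |t - c| * tent c l t ≤ l := by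
  rcases le_or_gt |t - c| l with h | h
  · exact (mul_le_of_le_one_right (abs_nonneg _) (tent_le_one hl t)).trans h
  · have hzero : tent c l t = 0 := max_eq_left (sub_nonpos.2 ((one_lt_div hl).2 h).le)
    rw [hzero, mul_zero]
    exact hl.le

theorem abs_tent_sub_le (hl : 0 < l) (t : ℝ) : |tent c l t - tent c l (t - 1)| ≤ 1 / l := by
  have hstep : |(|t - 1 - c| - |t - c|)| ≤ 1 := by
    refine (abs_abs_sub_abs_le _ _).trans_eq ?_
    rw [show t - 1 - c - (t - c) = -1 by ring, abs_neg, abs_one]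
  rw [tent, tent, max_comm 0, max_comm 0]
  refine (abs_max_sub_max_le_abs _ _ _).trans ?_
  rw [show 1 - |t - c| / l - (1 - |t - 1 - c| / l) = (|t - 1 - c| - |t - c|) / l by ring, abs_div,
    abs_of_pos hl]
  gcongr

theorem half_le_tent {t : ℝ} (hl : 0 < l) (h : |t - c| ≤ l / 2) : 1 / 2 ≤ tent c l t := by
  have hdiv : |t - c| / l ≤ 1 / 2 := by rw [div_le_iff₀ hl]; linarith
  exact le_max_of_le_right (by linarith)

end Tent

section Fluctuations

variable {ι A : Type*} [Fintype ι] [DecidableEq ι] [Fintype A] [DecidableEq A] {p : A → ℝ}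

theorem abs_tent_combination_le {N T l x : ℝ} (hl : 0 < l) (hx0 : 0 ≤ x) (hx1 : x ≤ 1)
    (hT0 : 0 ≤ T) (hT : T ≤ N) :
    |(1 - x) * (N - T) * tent ((1 - x) * N) l T - x * T * tent ((1 - x) * N) l (T - 1)| ≤
      l + N / l := by
  set c := (1 - x) * N with hc
  calc |(1 - x) * (N - T) * tent c l T - x * T * tent c l (T - 1)|
      = |-((T - c) * tent c l T) + x * T * (tent c l T - tent c l (T - 1))| := by
        rw [hc]; ring_nf
    _ ≤ |T - c| * tent c l T + x * T * |tent c l T - tent c l (T - 1)| := by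
        refine (abs_add_le _ _).trans_eq ?_
        rw [abs_neg, abs_mul, abs_mul, abs_of_nonneg (tent_nonneg c l T),
          abs_of_nonneg (mul_nonneg hx0 hT0)]
    _ ≤ l + N * (1 / l) := by
        gcongr
        · exact abs_mul_tent_le hl T
        · exact hT0.trans hT
        · exact (mul_le_of_le_one_left hT0 hx1).trans hT
        · exact abs_tent_sub_le hl T
    _ = l + N / l := by rw [mul_one_div]

theorem mean_tent_mul_changeSum_le (hp0 : ∀ a, 0 ≤ p a) (hp : ∑ a, p a = 1) (o : A)
    (f : (ι → A) → ℝ) {l : ℝ} (hl : 0 < l) :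
    p o * mean p (fun s => tent ((1 - p o) * Fintype.card ι) l (rareCount o s - 1) *
      changeSum o f s) ≤ (l + Fintype.card ι / l) * mean p (fun s => |f s - mean p f|) := by
  have hpo : p o ≤ 1 := hp ▸ Finset.single_le_sum (fun a _ => hp0 a) (Finset.mem_univ o)
  rw [mean_changeSum hp, ← mean_const_mul]
  refine mean_mono hp0 fun s => (le_abs_self _).trans ?_
  rw [abs_mul, mul_comm]
  gcongr
  exact abs_tent_combination_le hl (hp0 o) hpo (rareCount_nonneg o s) (rareCount_le o s)

theorem le_mean_tent_mul_changeSum (hp0 : ∀ a, 0 ≤ p a) (hp : ∑ a, p a = 1) (o : A)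
    (f : (ι → A) → ℝ) {l c : ℝ} (hl : 0 < l) (hc : 0 ≤ c)
    (hf : ∀ s, -(Fintype.card ι : ℝ) ≤ changeSum o f s) :
    c / 2 * (1 - prob p (fun s => changeSum o f s < c) -
        prob p (fun s : ι → A => l / 2 < |rareCount o s - 1 - (1 - p o) * Fintype.card ι|)) -
      Fintype.card ι * prob p (fun s => changeSum o f s < c) ≤
    mean p (fun s => tent ((1 - p o) * Fintype.card ι) l (rareCount o s - 1) *
      changeSum o f s) := by
  classical
  calc _ = mean p (fun s => c / 2 * (1 - (if changeSum o f s < c then 1 else 0) -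
        (if l / 2 < |rareCount o s - 1 - (1 - p o) * Fintype.card ι| then 1 else 0)) -
        Fintype.card ι * (if changeSum o f s < c then 1 else 0)) := by
        rw [mean_sub, mean_const_mul, mean_const_mul, mean_sub, mean_sub, mean_const hp]
        simp only [prob]
    _ ≤ _ := by
        refine mean_mono hp0 fun s => ?_
        have htent0 := tent_nonneg ((1 - p o) * Fintype.card ι) l (rareCount o s - 1)
        have htent1 := tent_le_one (c := (1 - p o) * Fintype.card ι) hl (rareCount o s - 1)
        have hs := hf s
        split_ifs with hsmall hfar hfar
        · nlinarith
        · nlinarith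
        · nlinarith
        · nlinarith [half_le_tent hl (not_lt.1 hfar)]

end Fluctuations

/-! ### Fluctuations of the longest common subsequence -/

section Deviations

variable {A : Type*} [Fintype A] [DecidableEq A] {p : A → ℝ} {o : A}

/-- The centered indicator function of the letters different from `o`. -/
def centeredRare (p : A → ℝ) (o a : A) : ℝ := (if a ≠ o then 1 else 0) - (1 - p o)

theorem sum_mul_centeredRare (hp : ∑ a, p a = 1) (o : A) : ∑ a, p a * centeredRare p o a = 0 := by
  simp only [centeredRare, mul_sub, Finset.sum_sub_distrib, sum_rare_mul hp, ← Finset.sum_mul, hp]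
  ring

theorem sum_mul_centeredRare_sq (hp : ∑ a, p a = 1) (o : A) :
    ∑ a, p a * centeredRare p o a ^ 2 = p o * (1 - p o) := by
  have hsq (a : A) : p a * centeredRare p o a ^ 2 =
      p a * centeredRare p o a * (2 * p o - 1) + p a * (p o * (1 - p o)) := by
    rw [centeredRare]
    split_ifs <;> ring
  simp only [hsq, Finset.sum_add_distrib, ← Finset.sum_mul, sum_mul_centeredRare hp, hp]
  ring

omit [Fintype A] in
theorem sum_centeredRare {ι : Type*} [Fintype ι] (p : A → ℝ) (o : A) (s : ι → A) :
    ∑ i, centeredRare p o (s i) = rareCount o s - (1 - p o) * Fintype.card ι := by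
  simp only [centeredRare, Finset.sum_sub_distrib, rareCount, Finset.sum_const, Finset.card_univ,
    nsmul_eq_mul]
  ring

theorem prob_lt_abs_sum_centeredRare_le (hp0 : ∀ a, 0 ≤ p a) (hp : ∑ a, p a = 1) (o : A)
    {ι : Type*} [Fintype ι] [DecidableEq ι] {c : ι → ℝ} (hc : ∀ i, c i ^ 2 = 1) {b : ℝ}
    (hb : 0 < b) : prob p (fun s : ι → A => b < |∑ i, c i * centeredRare p o (s i)|) ≤
      Fintype.card ι * (p o * (1 - p o)) / b ^ 2 := by
  refine (prob_lt_abs_le hp0 _ hb).trans_eq ?_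
  rw [mean_sq_sum hp _ (sum_mul_centeredRare hp o), sum_mul_centeredRare_sq hp]
  simp [hc]

end Deviations

section Pairs

variable {A : Type*} {n : ℕ}

/-- The two words of length `n` which make up `s`. -/
def words (s : Fin n ⊕ Fin n → A) : List A × List A :=
  (List.ofFn (s ∘ Sum.inl), List.ofFn (s ∘ Sum.inr))

theorem words_injective : Function.Injective (words : (Fin n ⊕ Fin n → A) → _) := by
  intro s s' h
  have hl := congrFun (List.ofFn_injective (congrArg Prod.fst h))
  have hr := congrFun (List.ofFn_injective (congrArg Prod.snd h))
  funext i
  cases i with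
  | inl i => exact hl i
  | inr i => exact hr i

/-- The length of the longest common subsequence of the two words which make up `s`. -/
noncomputable def pairLcs (s : Fin n ⊕ Fin n → A) : ℝ := lcsLength (s ∘ Sum.inl) (s ∘ Sum.inr)

theorem lcsLength_const (o : A) (n : ℕ) : lcsLength (fun _ : Fin n => o) (fun _ => o) = n := by
  refine le_antisymm ?_ ((isGreatest_lcsLength _ _).2 ⟨id, id, strictMono_id, strictMono_id,
    fun _ => rfl⟩)
  obtain ⟨i, -, hi, -, -⟩ := (isGreatest_lcsLength (fun _ : Fin n => o) (fun _ => o)).1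
  simpa using Fintype.card_le_of_injective i hi.injective

theorem lcsLength_const_of_ne {a b : A} (h : a ≠ b) (n : ℕ) :
    lcsLength (fun _ : Fin n => a) (fun _ => b) = 0 := by
  obtain ⟨i, j, -, -, hij⟩ := (isGreatest_lcsLength (fun _ : Fin n => a) (fun _ => b)).1
  by_contra hpos
  exact h (hij ⟨0, Nat.pos_of_ne_zero hpos⟩)

variable [DecidableEq A]

theorem sumFlip_ofFn (o : A) (F : List A → ℤ) (x : Fin n → A) :
    sumFlip o F (List.ofFn x) =
      ∑ i, if x i ≠ o then F (List.ofFn (Function.update x i o)) else 0 := by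
  induction n generalizing F with
  | zero => simp [sumFlip]
  | succ n ih =>
    rw [List.ofFn_succ, sumFlip, ih, Fin.sum_univ_succ]
    congr 1
    · simp [List.ofFn_succ]
    · refine Finset.sum_congr rfl fun i _ => ?_
      have htail : (fun j => Function.update x i.succ o (Fin.succ j)) =
          Function.update (fun j => x (Fin.succ j)) i o :=
        Function.update_comp_eq_of_injective x (Fin.succ_injective n) i o
      rw [List.ofFn_succ, Function.update_of_ne (Fin.succ_ne_zero i).symm, htail]

theorem changeSum_pairLcs (o : A) (s : Fin n ⊕ Fin n → A) :
    changeSum o pairLcs s = flipSum o (words s).1 (words s).2 := by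
  simp only [flipSum, words, sumFlip_ofFn, changeSum, Fintype.sum_sum_type, pairLcs,
    Sum.update_inl_comp_inl, Sum.update_inl_comp_inr, Sum.update_inr_comp_inl,
    Sum.update_inr_comp_inr, lcsLength_eq_listLcs]
  push_cast
  rfl

theorem neg_le_flipSum (o : A) (x y : List A) : -(2 * x.length : ℤ) ≤ flipSum o x y := by
  obtain ⟨π, rfl, rfl, hopt⟩ := exists_isOptimal o x y
  have hfst := π.gain_sub_length_le_sumFlip
  have hsnd := π.gain_swap_sub_length_le_sumFlip
  have hlength := π.length_le_length_fst
  rw [hopt] at hfst hsnd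
  rw [flipSum]
  omega

theorem neg_card_le_changeSum_pairLcs (o : A) (s : Fin n ⊕ Fin n → A) :
    -(Fintype.card (Fin n ⊕ Fin n) : ℝ) ≤ changeSum o pairLcs s := by
  have h := neg_le_flipSum o (words s).1 (words s).2
  rw [words, List.length_ofFn, ← words] at h
  rw [changeSum_pairLcs, Fintype.card_sum, Fintype.card_fin, ← two_mul]
  exact_mod_cast h

theorem count_ofFn (o : A) (x : Fin n → A) :
    ((List.ofFn x).count o : ℝ) = n - rareCount o x := by
  trans ∑ i, if x i = o then 1 else 0
  swap
  · rw [← card_sub_rareCount, Fintype.card_fin]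
  induction n with
  | zero => simp
  | succ n ih =>
    rw [List.ofFn_succ, List.count_cons, Fin.sum_univ_succ, ← ih]
    by_cases h : x 0 = o <;> simp [h, add_comm]

end Pairs

theorem one_add_pow_le_one_add_mul_pow {a κ : ℝ} (ha : 0 ≤ a) (hκ0 : 0 ≤ κ) (hκ : κ ≤ 1)
    {E n : ℕ} (hE : E ≤ κ * n) : (1 + a) ^ E ≤ (1 + κ * a) ^ n := by
  calc (1 + a) ^ E = (1 + a) ^ (E : ℝ) := (Real.rpow_natCast _ _).symm
    _ ≤ (1 + a) ^ (κ * n) := Real.rpow_le_rpow_of_exponent_le (by linarith) hE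
    _ = ((1 + a) ^ κ) ^ n := by rw [Real.rpow_mul (by linarith), Real.rpow_natCast]
    _ ≤ (1 + κ * a) ^ n := by
      gcongr
      exact rpow_one_add_le_one_add_mul_self (by linarith) hκ0 hκ

namespace DominantLetter

variable {A : Type*} [Fintype A] [DecidableEq A] {p : A → ℝ} {o : A} {q : ℝ} {n : ℕ}

omit [DecidableEq A] in
theorem mul_one_sub_le (h : DominantLetter p o q) : p o * (1 - p o) ≤ 1 / 1000 := by
  nlinarith [h.large]

omit [DecidableEq A] in
theorem pairWt_growthWt_words (h : DominantLetter p o q) (s : Fin n ⊕ Fin n → A) :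
    pairWt (growthWt p q) (words s) =
      ENNReal.ofReal ((∏ i, p (s i)) * (1 + q ^ 2 / 1000) ^ (2 * n)) := by
  have hnonneg (i) : 0 ≤ p (s i) * (1 + q ^ 2 / 1000) := mul_nonneg (h.nonneg _) (by positivity)
  have hpow : (1 + q ^ 2 / 1000) ^ (2 * n) = ∏ _ : Fin n ⊕ Fin n, (1 + q ^ 2 / 1000) := by
    simp [two_mul]
  rw [hpow, ← Finset.prod_mul_distrib, ENNReal.ofReal_prod_of_nonneg fun i _ => hnonneg i,
    Fintype.prod_sum_type, pairWt, words, wt_ofFn, wt_ofFn]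
  rfl

omit [DecidableEq A] in
theorem tsum_pairWt_growthWt_image_words (h : DominantLetter p o q)
    (P : (Fin n ⊕ Fin n → A) → Prop) :
    ∑' d : words '' {s | P s}, pairWt (growthWt p q) d =
      ENNReal.ofReal (prob p P * (1 + q ^ 2 / 1000) ^ (2 * n)) := by
  classical
  rw [tsum_image _ words_injective.injOn,
    tsum_subtype {s | P s} fun s => pairWt (growthWt p q) (words s), tsum_fintype, prob, mean,
    Finset.sum_mul, ENNReal.ofReal_sum_of_nonneg fun s _ => ?_]
  · refine Finset.sum_congr rfl fun s _ => ?_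
    by_cases hs : P s <;> simp [Set.indicator, hs, h.pairWt_growthWt_words]
  · exact mul_nonneg (mul_nonneg (Finset.prod_nonneg fun i _ => h.nonneg _)
      (by split_ifs <;> norm_num)) (by positivity)

theorem prob_flipSum_mul_pow_le (h : DominantLetter p o q) (E : ℕ) :
    prob p (fun s : Fin n ⊕ Fin n → A => flipSum o (words s).1 (words s).2 +
        |((words s).1.count o : ℤ) - (words s).2.count o| ≤ E) * (1 + q ^ 2 / 1000) ^ (2 * n) ≤
      (21 / 20) ^ E * (20 / q ^ 2) := by
  have hq := h.q_pos
  have hτ : ENNReal.ofReal (20 / 21) ≤ 1 := ENNReal.ofReal_le_one.2 (by norm_num)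
  have ht : ENNReal.ofReal (21 / 20) * ENNReal.ofReal (20 / 21) = 1 := by
    rw [← ENNReal.ofReal_mul (by norm_num)]; norm_num
  have hle := (tsum_pairWt_mul_le (growthWt p q) hτ ht (E := E)
    (words '' {s : Fin n ⊕ Fin n → A | flipSum o (words s).1 (words s).2 +
      |((words s).1.count o : ℤ) - (words s).2.count o| ≤ E})
    (by rintro _ ⟨s, hs, rfl⟩; exact hs)).trans h.tsum_weight_growthWt_le
  rw [h.tsum_pairWt_growthWt_image_words, ← ENNReal.ofReal_pow (by norm_num),
    ← ENNReal.ofReal_mul (mul_nonneg (prob_nonneg h.nonneg _) (by positivity)),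
    ENNReal.ofReal_le_ofReal_iff (by positivity)] at hle
  rw [← le_div_iff₀ (by positivity)] at hle
  refine hle.trans_eq ?_
  rw [div_eq_mul_inv, ← inv_pow, inv_div, mul_comm]

theorem prob_flipSum_le (h : DominantLetter p o q) (hn : 1 ≤ n) :
    prob p (fun s : Fin n ⊕ Fin n → A => flipSum o (words s).1 (words s).2 +
        |((words s).1.count o : ℤ) - (words s).2.count o| ≤ ⌊2 * (q ^ 2 / 1000) * n⌋₊) ≤
      20000 / (q ^ 4 * n) := by
  have hq := h.q_pos
  have hpow := h.prob_flipSum_mul_pow_le (n := n) ⌊2 * (q ^ 2 / 1000) * n⌋₊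
  have hb := prob_nonneg h.nonneg fun s : Fin n ⊕ Fin n → A =>
    flipSum o (words s).1 (words s).2 + |((words s).1.count o : ℤ) - (words s).2.count o| ≤
      ⌊2 * (q ^ 2 / 1000) * n⌋₊
  set b := prob p fun s : Fin n ⊕ Fin n → A => _
  set z := (1 + q ^ 2 / 1000) ^ n with hz
  have hgrowth : (21 / 20 : ℝ) ^ ⌊2 * (q ^ 2 / 1000) * n⌋₊ ≤ z := by
    calc (21 / 20 : ℝ) ^ ⌊2 * (q ^ 2 / 1000) * n⌋₊
        ≤ (1 + 2 * (q ^ 2 / 1000) * (1 / 20)) ^ n := by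
          rw [show (21 / 20 : ℝ) = 1 + 1 / 20 by norm_num]
          exact one_add_pow_le_one_add_mul_pow (by norm_num) (by positivity)
            (by nlinarith [h.q_le]) (Nat.floor_le (by positivity))
      _ ≤ z := by
          rw [hz]
          gcongr
          linarith [sq_nonneg q]
  have hbz : b * z ≤ 20 / q ^ 2 := by
    refine le_of_mul_le_mul_right ?_ (by positivity : 0 < z)
    calc b * z * z = b * (1 + q ^ 2 / 1000) ^ (2 * n) := by rw [hz]; ring
      _ ≤ (21 / 20) ^ ⌊2 * (q ^ 2 / 1000) * n⌋₊ * (20 / q ^ 2) := hpow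
      _ ≤ z * (20 / q ^ 2) := by gcongr
      _ = 20 / q ^ 2 * z := mul_comm _ _
  have hbernoulli : 1 + n * (q ^ 2 / 1000) ≤ z :=
    one_add_mul_le_pow (by linarith [sq_nonneg q]) n
  have hbn : b * (n * (q ^ 2 / 1000)) ≤ 20 / q ^ 2 :=
    (mul_le_mul_of_nonneg_left (by linarith) hb).trans hbz
  rw [le_div_iff₀ (by positivity)] at hbn ⊢
  linarith

theorem prob_imbalance_le (h : DominantLetter p o q) {b : ℝ} (hb : 0 < b) :
    prob p (fun s : Fin n ⊕ Fin n → A =>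
      b < |((words s).1.count o : ℝ) - (words s).2.count o|) ≤ n / (500 * b ^ 2) := by
  have hsum (s : Fin n ⊕ Fin n → A) :
      ∑ i, (Sum.elim (fun _ => -1) fun _ => 1) i * centeredRare p o (s i) =
        ((words s).1.count o : ℝ) - (words s).2.count o := by
    rw [words, count_ofFn, count_ofFn, Fintype.sum_sum_type]
    simp only [Sum.elim_inl, Sum.elim_inr, ← Finset.mul_sum]
    rw [sum_centeredRare p o fun i => s (Sum.inl i), sum_centeredRare p o fun i => s (Sum.inr i)]
    simp only [Function.comp_def]
    ring
  have hdev := prob_lt_abs_sum_centeredRare_le h.nonneg h.sum_eq o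
    (c := (Sum.elim (fun _ => -1) fun _ => 1 : Fin n ⊕ Fin n → ℝ))
    (by rintro (i | i) <;> simp) hb
  simp only [hsum] at hdev
  refine hdev.trans ?_
  rw [Fintype.card_sum, Fintype.card_fin, ← div_div]
  push_cast
  gcongr
  nlinarith [h.mul_one_sub_le, Nat.cast_nonneg (α := ℝ) n]

theorem prob_window_le (h : DominantLetter p o q) (hn : 1 ≤ n) :
    prob p (fun s : Fin n ⊕ Fin n → A => 4 * √n / 2 <
      |rareCount o s - 1 - (1 - p o) * Fintype.card (Fin n ⊕ Fin n)|) ≤ 1 / 4 := by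
  have hn' : (1 : ℝ) ≤ n := by exact_mod_cast hn
  have hsqrt : 1 ≤ √(n : ℝ) := Real.one_le_sqrt.2 hn'
  have hdev := prob_lt_abs_sum_centeredRare_le h.nonneg h.sum_eq o
    (c := fun _ : Fin n ⊕ Fin n => (1 : ℝ)) (by simp) (by positivity : 0 < √(n : ℝ))
  simp only [one_mul, sum_centeredRare] at hdev
  refine (prob_mono h.nonneg fun s hs => ?_).trans (hdev.trans ?_)
  · have htri := abs_sub (rareCount o s - (1 - p o) * Fintype.card (Fin n ⊕ Fin n)) 1
    rw [abs_one, sub_right_comm] at htri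
    linarith
  · rw [Real.sq_sqrt (by positivity), div_le_iff₀ (by positivity), Fintype.card_sum,
      Fintype.card_fin]
    push_cast
    nlinarith [h.mul_one_sub_le]

theorem prob_changeSum_lt_le (h : DominantLetter p o q) (hn : 1 ≤ n) :
    prob p (fun s : Fin n ⊕ Fin n → A => changeSum o pairLcs s < q ^ 2 / 1000 * n) ≤
      30000 / (q ^ 4 * n) := by
  have hq := h.q_pos
  have himbalance := h.prob_imbalance_le (n := n) (b := q ^ 2 / 1000 * n) (by positivity)
  have hbound : n / (500 * (q ^ 2 / 1000 * n) ^ 2) ≤ 10000 / (q ^ 4 * n) := by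
    rw [div_le_div_iff₀ (by positivity) (by positivity)]
    nlinarith [show 0 < q ^ 4 * n ^ 2 by positivity]
  refine (prob_mono h.nonneg fun s hs => ?_).trans ((prob_or_le h.nonneg _ _).trans
    ((add_le_add (h.prob_flipSum_le hn) (himbalance.trans hbound)).trans_eq (by ring)))
  refine or_iff_not_imp_right.2 fun hbalanced => ?_
  rw [changeSum_pairLcs] at hs
  have hlt : ((flipSum o (words s).1 (words s).2 +
      |((words s).1.count o : ℤ) - (words s).2.count o| : ℤ) : ℝ) < 2 * (q ^ 2 / 1000) * n := by
    push_cast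
    linarith
  refine Int.lt_add_one_iff.1 ?_
  exact_mod_cast hlt.trans (Nat.lt_floor_add_one _)

theorem le_mean_tent_mul_changeSum_pairLcs (h : DominantLetter p o q)
    (hn : 1000000000 / q ^ 6 ≤ n) : q ^ 2 / 8000 * n ≤
      mean p (fun s : Fin n ⊕ Fin n → A =>
        tent ((1 - p o) * Fintype.card (Fin n ⊕ Fin n)) (4 * √n) (rareCount o s - 1) *
          changeSum o pairLcs s) := by
  have hq := h.q_pos
  have hn0 : (0 : ℝ) < n := lt_of_lt_of_le (by positivity) hn
  have hn1 : 1 ≤ n := by exact_mod_cast Nat.cast_pos.1 hn0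
  have hrare : prob p (fun s : Fin n ⊕ Fin n → A => changeSum o pairLcs s < q ^ 2 / 1000 * n) ≤
      q ^ 2 / 16000 := by
    refine (h.prob_changeSum_lt_le hn1).trans ?_
    rw [div_le_iff₀ (by positivity)] at hn ⊢
    nlinarith
  have hquarter : q ^ 2 / 16000 ≤ 1 / 4 := by nlinarith [h.q_le]
  refine le_trans ?_ (le_mean_tent_mul_changeSum h.nonneg h.sum_eq o pairLcs (l := 4 * √n)
    (c := q ^ 2 / 1000 * n) (by positivity) (by positivity) (neg_card_le_changeSum_pairLcs o))
  have hcard : (Fintype.card (Fin n ⊕ Fin n) : ℝ) = 2 * n := by simp [two_mul]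
  have hwindow := h.prob_window_le hn1
  rw [hcard] at hwindow ⊢
  calc q ^ 2 / 8000 * n
      = q ^ 2 / 1000 * n / 2 * (1 - 1 / 4 - 1 / 4) - 2 * n * (q ^ 2 / 16000) := by ring
    _ ≤ _ := by
      gcongr
      exact hrare.trans hquarter

omit [DecidableEq A] in
theorem le_mean_abs_sub_of_large (h : DominantLetter p o q) (hn : 1000000000 / q ^ 6 ≤ n) :
    q ^ 2 / 40000 * √n ≤
      mean p (fun s : Fin n ⊕ Fin n → A => |pairLcs s - mean p (pairLcs (n := n))|) := by
  classical
  have hq := h.q_pos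
  have hn0 : (0 : ℝ) < n := lt_of_lt_of_le (by positivity) hn
  have hupper := mean_tent_mul_changeSum_le h.nonneg h.sum_eq o (pairLcs (n := n)) (l := 4 * √n)
    (by positivity)
  have hwidth : 4 * √n + Fintype.card (Fin n ⊕ Fin n) / (4 * √n) = 9 / 2 * √(n : ℝ) := by
    have := Real.mul_self_sqrt hn0.le
    rw [Fintype.card_sum, Fintype.card_fin]
    field_simp
    push_cast
    linarith
  rw [hwidth] at hupper
  have hlower := mul_le_mul h.large (h.le_mean_tent_mul_changeSum_pairLcs hn) (by positivity)
    (by linarith [h.large])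
  refine le_of_mul_le_mul_left ?_ (Real.sqrt_pos.2 hn0)
  linear_combination 2 / 9 * hlower + 2 / 9 * hupper +
    q ^ 2 / 40000 * Real.mul_self_sqrt hn0.le +
    (2 / 9 * (999 / 1000) / 8000 - 1 / 40000) * (by positivity : 0 ≤ q ^ 2 * (n : ℝ))

omit [DecidableEq A] in
theorem le_mean_abs_sub_of_pos (h : DominantLetter p o q) (hn : 1 ≤ n) :
    q ^ (2 * n) * n ≤
      mean p (fun s : Fin n ⊕ Fin n → A => |pairLcs s - mean p (pairLcs (n := n))|) := by
  classical
  have hq := h.q_pos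
  have ho := h.nonneg o
  have hqo : q ≤ p o := by linarith [h.q_le, h.large]
  obtain ⟨a, ha, hpa⟩ := h.exists_eq
  set M := mean p (pairLcs (n := n))
  let pair (c : A) : Fin n ⊕ Fin n → A := Sum.elim (fun _ => o) fun _ => c
  have hne : pair o ≠ pair a := fun he => ha (congrFun he (Sum.inr ⟨0, hn⟩)).symm
  have hweight {c : A} (hc : q ≤ p c) : q ^ (2 * n) ≤ ∏ i, p (pair c i) := by
    simp only [pair, Fintype.prod_sum_type, Sum.elim_inl, Sum.elim_inr, Finset.prod_const,
      Finset.card_univ, Fintype.card_fin]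
    rw [two_mul, pow_add]
    gcongr
  have hlcs : pairLcs (pair o) = n := congrArg Nat.cast (lcsLength_const o n)
  have hlcs_ne : pairLcs (pair a) = 0 :=
    (congrArg Nat.cast (lcsLength_const_of_ne ha.symm n)).trans Nat.cast_zero
  calc q ^ (2 * n) * n ≤ q ^ (2 * n) * (|n - M| + |0 - M|) := by
        gcongr
        have htri := abs_sub (n - M) (0 - M)
        rw [sub_sub_sub_cancel_right, sub_zero] at htri
        exact (le_abs_self _).trans htri
    _ ≤ (∏ i, p (pair o i)) * |pairLcs (pair o) - M| +
        (∏ i, p (pair a i)) * |pairLcs (pair a) - M| := by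
        rw [mul_add, hlcs, hlcs_ne]
        gcongr
        exacts [hweight hqo, hweight hpa.ge]
    _ = ∑ s ∈ {pair o, pair a}, (∏ i, p (s i)) * |pairLcs s - M| := by
        rw [Finset.sum_pair hne]
    _ ≤ mean p fun s => |pairLcs s - M| :=
        Finset.sum_le_sum_of_subset_of_nonneg (Finset.subset_univ _) fun s _ _ =>
          mul_nonneg (Finset.prod_nonneg fun i _ => h.nonneg _) (abs_nonneg _)

end DominantLetter

theorem exists_le_mean_abs_sub {q : ℝ} (hq : 0 < q) :
    ∃ c : ℝ, 0 < c ∧ ∀ {A : Type*} [Fintype A] {p : A → ℝ} {o : A}, DominantLetter p o q →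
      ∀ {n : ℕ}, 1 ≤ n → c * √n ≤
        mean p (fun s : Fin n ⊕ Fin n → A => |pairLcs s - mean p (pairLcs (n := n))|) := by
  obtain ⟨N, hN⟩ := exists_nat_ge (1000000000 / q ^ 6)
  refine ⟨min (q ^ 2 / 40000) (q ^ (2 * N)), by positivity, fun h n hn => ?_⟩
  rcases le_total N n with hle | hle
  · refine le_trans ?_ (h.le_mean_abs_sub_of_large (hN.trans (Nat.cast_le.2 hle)))
    gcongr
    exact min_le_left _ _
  · refine le_trans ?_ (h.le_mean_abs_sub_of_pos hn)
    have hsqrt : √(n : ℝ) ≤ n := by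
      have hn' : (1 : ℝ) ≤ n := by exact_mod_cast hn
      exact Real.sqrt_le_iff.2 ⟨by linarith, by nlinarith⟩
    have hpow : q ^ (2 * N) ≤ q ^ (2 * n) :=
      pow_le_pow_of_le_one hq.le (by linarith [h.q_le]) (by omega)
    exact mul_le_mul ((min_le_right _ _).trans hpow) hsqrt (Real.sqrt_nonneg _) (by positivity)

section Transfer

open MeasureTheory ProbabilityTheory

variable {Ω : Type*} [MeasurableSpace Ω] {μ : Measure Ω} {m : ℕ} {p : Fin m → ℝ}
  {X Y : ℕ → Ω → Fin m}

/-- The first `n` letters of both sequences. -/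
def pairWord (X Y : ℕ → Ω → Fin m) (n : ℕ) (ω : Ω) : Fin n ⊕ Fin n → Fin m :=
  Sum.elim (fun i => X i ω) (fun i => Y i ω)

theorem IsIIDPair.measurable_pairWord (h : IsIIDPair μ p X Y) (n : ℕ) :
    Measurable (pairWord X Y n) := by
  rw [measurable_pi_iff]
  rintro (i | i)
  · exact h.measurable_X i
  · exact h.measurable_Y i

theorem measureReal_iInter_preimage_singleton (hX : iIndepFun X μ)
    (hp : ∀ i k, μ.real (X i ⁻¹' {k}) = p k) {n : ℕ} (x : Fin n → Fin m) :
    μ.real (⋂ i : Fin n, X i ⁻¹' {x i}) = ∏ i, p (x i) := by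
  have hindep := (hX.precomp (g := fun i : Fin n => (i : ℕ)) Fin.val_injective)
    |>.measure_inter_preimage_eq_mul Finset.univ (sets := fun i => {x i})
      (fun i _ => measurableSet_singleton _)
  simp only [Finset.mem_univ, Set.iInter_true] at hindep
  rw [measureReal_def, hindep, ENNReal.toReal_prod]
  exact Finset.prod_congr rfl fun i _ => hp i (x i)

theorem IsIIDPair.measureReal_pairWord (h : IsIIDPair μ p X Y) {n : ℕ}
    (s : Fin n ⊕ Fin n → Fin m) : μ.real (pairWord X Y n ⁻¹' {s}) = ∏ i, p (s i) := by
  have hindep := h.indep_XY.measure_inter_preimage_eq_mul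
    (⋂ i : Fin n, {f : ℕ → Fin m | f i = s (Sum.inl i)})
    (⋂ i : Fin n, {f : ℕ → Fin m | f i = s (Sum.inr i)})
    (MeasurableSet.iInter fun i => measurable_pi_apply (i : ℕ) (measurableSet_singleton _))
    (MeasurableSet.iInter fun i => measurable_pi_apply (i : ℕ) (measurableSet_singleton _))
  simp only [Set.preimage_iInter] at hindep
  have hinter : pairWord X Y n ⁻¹' {s} =
      (⋂ i : Fin n, X i ⁻¹' {s (Sum.inl i)}) ∩ ⋂ i : Fin n, Y i ⁻¹' {s (Sum.inr i)} := by
    ext ω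
    simp only [pairWord, Set.mem_preimage, Set.mem_singleton_iff, Set.mem_inter_iff,
      Set.mem_iInter, funext_iff, Sum.forall, Sum.elim_inl, Sum.elim_inr]
  rw [Fintype.prod_sum_type, ← measureReal_iInter_preimage_singleton h.indep_X h.law_X,
    ← measureReal_iInter_preimage_singleton h.indep_Y h.law_Y, hinter, measureReal_def,
    measureReal_def, measureReal_def, ← ENNReal.toReal_mul]
  exact congrArg ENNReal.toReal hindep

theorem IsIIDPair.nonneg (h : IsIIDPair μ p X Y) (k : Fin m) : 0 ≤ p k := by
  rw [← h.law_X 0 k]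
  exact measureReal_nonneg

variable [IsProbabilityMeasure μ]

theorem IsIIDPair.sum_eq_one (h : IsIIDPair μ p X Y) : ∑ k, p k = 1 := by
  have hsum : ∑ k, μ.real (X 0 ⁻¹' {k}) = μ.real (X 0 ⁻¹' ↑(Finset.univ : Finset (Fin m))) :=
    sum_measureReal_preimage_singleton Finset.univ
      fun k _ => h.measurable_X 0 (measurableSet_singleton k)
  simpa [h.law_X] using hsum

theorem IsIIDPair.integral_pairWord (h : IsIIDPair μ p X Y) {n : ℕ}
    (G : (Fin n ⊕ Fin n → Fin m) → ℝ) : ∫ ω, G (pairWord X Y n ω) ∂μ = mean p G := by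
  have hmeas := h.measurable_pairWord n
  have : IsProbabilityMeasure (μ.map (pairWord X Y n)) :=
    Measure.isProbabilityMeasure_map hmeas.aemeasurable
  rw [← integral_map (φ := pairWord X Y n) hmeas.aemeasurable
    (Measurable.of_discrete.aestronglyMeasurable), integral_fintype (Integrable.of_finite), mean]
  refine Finset.sum_congr rfl fun s _ => ?_
  rw [map_measureReal_apply hmeas (measurableSet_singleton s), h.measureReal_pairWord, smul_eq_mul]

theorem IsIIDPair.absCentralMoment_LC (h : IsIIDPair μ p X Y) (n : ℕ) (r : ℝ) :
    absCentralMoment μ (LC X Y n) r =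
      mean p (fun s : Fin n ⊕ Fin n → Fin m => |pairLcs s - mean p (pairLcs (n := n))| ^ r) := by
  have hLC (ω : Ω) : LC X Y n ω = pairLcs (pairWord X Y n ω) := rfl
  simp only [absCentralMoment, hLC, h.integral_pairWord pairLcs]
  exact h.integral_pairWord fun s => |pairLcs s - mean p (pairLcs (n := n))| ^ r

end Transfer

theorem K_le_inv_two_pow (m : ℕ) : K m ≤ 1 / 2 ^ 67 := by
  have hexp : (2 : ℝ) ^ 67 ≤ Real.exp 67 := by
    calc (2 : ℝ) ^ 67 ≤ Real.exp 1 ^ 67 := by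
          gcongr
          linarith [Real.add_one_le_exp (1 : ℝ)]
      _ = Real.exp 67 := by rw [← Real.exp_nat_mul]; norm_num
  calc K m ≤ (2 : ℝ)⁻¹ ^ 4 * (10 : ℝ)⁻¹ ^ 2 * Real.exp (-67) := min_le_left _ _
    _ ≤ 1 * Real.exp (-67) := by gcongr; norm_num
    _ = 1 / Real.exp 67 := by rw [Real.exp_neg]; ring
    _ ≤ 1 / 2 ^ 67 := by gcongr

theorem natCast_mul_K_div_le (m : ℕ) : m * (K m / (2 * (m : ℝ) ^ 2)) ≤ 1 / 1000000 := by
  rcases m.eq_zero_or_pos with rfl | hm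
  · norm_num
  have hm1 : (1 : ℝ) ≤ m := by exact_mod_cast hm
  calc m * (K m / (2 * (m : ℝ) ^ 2)) = K m / (2 * m) := by field_simp
    _ ≤ 1 / 2 ^ 67 / (2 * 1) := by
      gcongr
      exact K_le_inv_two_pow m
    _ ≤ 1 / 1000000 := by norm_num

theorem K_div_le (m : ℕ) : K m / (2 * (m : ℝ) ^ 2) ≤ 1 / 1000000 := by
  rcases m.eq_zero_or_pos with rfl | hm
  · norm_num
  have hK : 0 ≤ K m := by rw [K]; positivity
  exact (le_mul_of_one_le_left (by positivity) (by exact_mod_cast hm)).trans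
    (natCast_mul_K_div_le m)

theorem one_sub_card_mul_le {A : Type*} [Fintype A] {p : A → ℝ} {o : A} {q : ℝ}
    (hp : ∑ a, p a = 1) (hq0 : 0 ≤ q) (hq : ∀ a, a ≠ o → p a ≤ q) :
    1 - Fintype.card A * q ≤ p o := by
  classical
  rw [← hp, sub_le_iff_le_add, ← Finset.add_sum_erase _ p (Finset.mem_univ o)]
  gcongr
  calc ∑ a ∈ Finset.univ.erase o, p a ≤ ∑ _ ∈ Finset.univ.erase o, q :=
        Finset.sum_le_sum fun a ha => hq a (Finset.ne_of_mem_erase ha)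
    _ ≤ ∑ _ : A, q := Finset.sum_le_sum_of_subset_of_nonneg (Finset.subset_univ _)
        fun _ _ _ => hq0
    _ = Fintype.card A * q := by simp

theorem IsIIDPair.large_of_le_K_div {Ω : Type*} [MeasurableSpace Ω] {μ : MeasureTheory.Measure Ω}
    [MeasureTheory.IsProbabilityMeasure μ] {m : ℕ} {p : Fin m → ℝ} {X Y : ℕ → Ω → Fin m}
    (h : IsIIDPair μ p X Y) {q : ℝ} (hq0 : 0 ≤ q) (hq : q ≤ K m / (2 * (m : ℝ) ^ 2)) {o : Fin m}
    (hle : q ∈ upperBounds (p '' {j | j ≠ o})) : 999 / 1000 ≤ p o := by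
  have hmul := (mul_le_mul_of_nonneg_left hq m.cast_nonneg).trans (natCast_mul_K_div_le m)
  have hsub := one_sub_card_mul_le h.sum_eq_one hq0 fun a ha => hle ⟨a, ha, rfl⟩
  rw [Fintype.card_fin] at hsub
  linarith

end LCS

theorem theorem1_general {r : ℝ} (hr : 1 ≤ r) {q : ℝ} (hq0 : 0 < q) (hq : q ≤ 1 / 1000000) :
    ∃ C : ℝ, 0 < C ∧
      ∀ (m : ℕ) (p : Fin m → ℝ) (j₀ : Fin m), 999 / 1000 ≤ p j₀ →
      IsGreatest (p '' {j | j ≠ j₀}) q →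
      ∀ (Ω : Type*) [MeasurableSpace Ω] (μ : MeasureTheory.Measure Ω)
        [MeasureTheory.IsProbabilityMeasure μ] (X Y : ℕ → Ω → Fin m),
        LCS.IsIIDPair μ p X Y →
        ∀ n : ℕ, 1 ≤ n →
          C * (n : ℝ) ^ (r / 2) ≤ LCS.absCentralMoment μ (LCS.LC X Y n) r := by
  obtain ⟨c, hc, hmean⟩ := LCS.exists_le_mean_abs_sub hq0
  refine ⟨c ^ r, Real.rpow_pos_of_pos hc r, ?_⟩
  intro m p j₀ hlarge hg Ω _ μ _ X Y h n hn
  have hp : LCS.DominantLetter p j₀ q :=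
    ⟨h.nonneg, h.sum_eq_one, hq0, hq, fun a ha => hg.2 ⟨a, ha, rfl⟩, hg.1, hlarge⟩
  calc c ^ r * (n : ℝ) ^ (r / 2) = (c * √n) ^ r := by
        rw [Real.mul_rpow hc.le (Real.sqrt_nonneg _), Real.sqrt_eq_rpow,
          ← Real.rpow_mul n.cast_nonneg, one_div_mul_eq_div]
    _ ≤ LCS.mean p (fun s => |LCS.pairLcs s - LCS.mean p (LCS.pairLcs (n := n))|) ^ r :=
        Real.rpow_le_rpow (by positivity) (hmean hp hn) (by linarith)
    _ ≤ LCS.mean p (fun s => |LCS.pairLcs s - LCS.mean p (LCS.pairLcs (n := n))| ^ r) :=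
        Real.rpow_arith_mean_le_arith_mean_rpow Finset.univ _ _
          (fun s _ => Finset.prod_nonneg fun i _ => h.nonneg _)
          (LCS.sum_prod_eq_one h.sum_eq_one) (fun s _ => abs_nonneg _) hr
    _ = LCS.absCentralMoment μ (LCS.LC X Y n) r := (h.absCentralMoment_LC n r).symm

theorem theorem1 (r : ℝ) (hr : 1 ≤ r) (m : ℕ) (pmax q : ℝ)
    (hpmax : 1 / 2 < pmax) (hq0 : 0 < q)
    (hq : q ≤ min ((2 : ℝ)⁻¹ ^ 2 * Real.exp (-5) * LCS.K m / (m : ℝ))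
      (LCS.K m / (2 * (m : ℝ) ^ 2))) :
    ∃ C : ℝ, 0 < C ∧
      ∀ (p : Fin m → ℝ) (j₀ : Fin m), p j₀ = pmax → IsGreatest (p '' {j | j ≠ j₀}) q →
      ∀ (Ω : Type*) [MeasurableSpace Ω] (μ : MeasureTheory.Measure Ω)
        [MeasureTheory.IsProbabilityMeasure μ] (X Y : ℕ → Ω → Fin m),
        LCS.IsIIDPair μ p X Y →
        ∀ n : ℕ, 1 ≤ n →
          C * (n : ℝ) ^ (r / 2) ≤ LCS.absCentralMoment μ (LCS.LC X Y n) r := by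
  have hqK := hq.trans (min_le_right _ _)
  obtain ⟨C, hC, hmoment⟩ := theorem1_general hr hq0 (hqK.trans (LCS.K_div_le m))
  exact ⟨C, hC, fun p j₀ _ hg Ω _ μ _ X Y h =>
    hmoment m p j₀ (h.large_of_le_K_div hq0.le hqK hg.2) hg Ω μ X Y h⟩
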